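/- **Setting and conventions.** Let $(\overline M,\overline g)$ and $(\widetilde M,\widetilde g)$ be connected smooth semi-Riemannian manifolds of dimensions $p$ and $n-p$, $1\le p<n$, let $f$ be a positive smooth function on $\overline M$, and let $M=\overline M\times_f\widetilde M$ be the warped product: the manifold $\overline M\times\widetilde M$ with the metric $g=\pi^*\overline g+(f\circ\pi)\,\sigma^*\widetilde g$, where $\pi,\sigma$ are the projections. For a semi-Riemannian metric $g$ put $R_{hijk}=g_{hl}(\partial_k\Gamma^l_{ij}-\partial_j\Gamma^l_{ik}+\Gamma^m_{ij}\Gamma^l_{mk}-\Gamma^m_{ik}\Gamma^l_{mj})$, $S_{jk}=g^{il}R_{ijkl}$, $S^2_{ij}=g^{kl}S_{ik}S_{jl}$; for symmetric $(0,2)$-tensors $A,E$ let $(A\wedge E)_{ijkl}=A_{il}E_{jk}+A_{jk}E_{il}-A_{ik}E_{jl}-A_{jl}E_{ik}$. Bars and tildes denote the objects of $\overline g$ and $\widetilde g$. On $\overline M$ put $f_a=\partial_a f$ and $$T_{ab}=-\tfrac1{2f}\Big(\overline\nabla_b f_a-\tfrac1{2f}f_af_b\Big),\quad T^2_{ab}=\overline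 g^{cd}T_{ac}T_{bd},\quad (\overline S\cdot T)_{ab}=\overline g^{cd}(\overline S_{ac}T_{bd}+T_{ac}\overline S_{bd}),$$ $$P=\tfrac1{4f^2}\overline g^{ab}f_af_b,\qquad Q=f\big(\operatorname{tr}T-(n-p-1)P\big),\qquad \operatorname{tr}T=\overline g^{ab}T_{ab}.$$ **Theorem 5.1.** Let $L_1,\dots,L_6$ be real functions on $M$, and write $q=n-p$. Then $$R=L_1\,g\wedge g+L_2\,g\wedge S+L_3\,S\wedge S+L_4\,g\wedge S^2+L_5\,S\wedge S^2+L_6\,S^2\wedge S^2$$ holds on $M$ if and only if the following three conditions hold at every point $(x,y)$ of $M$ (with $L_i=L_i(x,y)$, the base tensors and $f,P,Q$ taken at $x$, the fiber tensors at $y$). (i) $\overline R=\sum_{r,s=1}^{6}A_{rs}\,V_r\wedge V_s$, where $(V_1,\dots,V_6)=(\overline g,\overline S,\overline S^2,T,T^2,\overline S\cdot T)$ and $$A=\begin{pmatrix} L_1&\frac{L_2}{2}&\frac{L_4}{2}&\frac{qL_2}{2}&\frac{q^2L_4}{2}&\frac{qL_4}{2}\\ \frac{L_2}{2}&L_3&\frac{L_5}{2}&qL_3&\frac{q^2L_5}{2}&\frac{qL_5}{2}\\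 \frac{L_4}{2}&\frac{L_5}{2}&L_6&\frac{qL_5}{2}&q^2L_6&qL_6\\ \frac{qL_2}{2}&qL_3&\frac{qL_5}{2}&q^2L_3&\frac{q^3L_5}{2}&\frac{q^2L_5}{2}\\ \frac{q^2L_4}{2}&\frac{q^2L_5}{2}&q^2L_6&\frac{q^3L_5}{2}&q^4L_6&q^3L_6\\ \frac{qL_4}{2}&\frac{qL_5}{2}&qL_6&\frac{q^2L_5}{2}&q^3L_6&q^2L_6 \end{pmatrix}.$$ (ii) $\sum_{r=1}^{6}\sum_{s=1}^{3}B_{rs}\,(V_r)_{ab}(W_s)_{\alpha\beta}=0$ for all base indices $a,b$ and fiber indices $\alpha,\beta$, where $(W_1,W_2,W_3)=(\widetilde g,\widetilde S,\widetilde S^2)$ and $$B=\begin{pmatrix} -\frac{L_4Q^2}{f}-L_2Q-2fL_1&-L_2-\frac{2L_4Q}{f}&-\frac{L_4}{f}\\ -\frac{L_5Q^2}{f}-2L_3Q-fL_2&-\frac{2(fL_3+L_5Q)}{f}&-\frac{L_5}{f}\\ -\frac{2L_6Q^2}{f}-L_5Q-fL_4&-L_5-\frac{4L_6Q}{f}&-\frac{2L_6}{f}\\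 f(1-qL_2)-\frac{qL_5Q^2}{f}-2qL_3Q&-\frac{2q(fL_3+L_5Q)}{f}&-\frac{qL_5}{f}\\ -\frac{q^2(L_4f^2+L_5Qf+2L_6Q^2)}{f}&-\frac{q^2(fL_5+4L_6Q)}{f}&-\frac{2q^2L_6}{f}\\ -\frac{q(L_4f^2+L_5Qf+2L_6Q^2)}{f}&-\frac{q(fL_5+4L_6Q)}{f}&-\frac{2qL_6}{f} \end{pmatrix}.$$ (iii) $f\widetilde R=\sum_{r,s=1}^{3}C_{rs}\,W_r\wedge W_s$, where $C$ is the symmetric matrix with $$\begin{aligned} C_{11}&=\tfrac{L_6Q^4}{f^2}+\tfrac{L_5Q^3}{f}+(L_3+L_4)Q^2+fL_2Q+f^2L_1+\tfrac{f^2P}{2},\\ C_{12}&=(L_3+L_4)Q+\tfrac{L_2f^3+3L_5Q^2f+4L_6Q^3}{2f^2},\qquad C_{13}=\tfrac12\Big(L_4+\tfrac{Q(fL_5+2L_6Q)}{f^2}\Big),\\ C_{22}&=L_3+\tfrac{2Q(fL_5+2L_6Q)}{f^2},\qquad C_{23}=\tfrac{fL_5+4L_6Q}{2f^2},\qquad C_{33}=\tfrac{L_6}{f^2}.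 \end{aligned}$$ -/

import Mathlib

open scoped Manifold ContDiff Matrix

noncomputable section

namespace WarpedRoter

/-! ### Tensor calculus in coordinates

Coordinates on an open piece of a finite-dimensional real vector space `E` are taken with respect to
a basis `b` of `E`, and `G z` is the matrix of the components `g_{ij}` of a metric at the point
with coordinates `z`. -/

section Coordinates

variable {ι : Type*} [Fintype ι] [DecidableEq ι]
variable {E : Type*} [NormedAddCommGroup E] [NormedSpace ℝ E]

/-- The partial derivative `∂_i h`. -/
def pd (b : Module.Basis ι ℝ E) (i : ι) (h : E → ℝ) (z : E) : ℝ :=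
  fderiv ℝ h z (b i)

/-- The Christoffel symbols `Γ^k_{ij}` of the Levi-Civita connection. -/
def christoffel (b : Module.Basis ι ℝ E) (G : E → Matrix ι ι ℝ) (k i j : ι) (z : E) : ℝ :=
  (1 / 2) * ∑ l, (G z)⁻¹ k l *
    (pd b i (fun w => G w j l) z + pd b j (fun w => G w i l) z - pd b l (fun w => G w i j) z)

/-- The components `R_{hijk}` of the Riemann-Christoffel curvature tensor,
`R_{hijk} = g_{hl} (∂_k Γ^l_{ij} - ∂_j Γ^l_{ik} + Γ^m_{ij} Γ^l_{mk} - Γ^m_{ik} Γ^l_{mj})`. -/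
def riemann (b : Module.Basis ι ℝ E) (G : E → Matrix ι ι ℝ) (z : E) (h i j k : ι) : ℝ :=
  ∑ l, G z h l *
    (pd b k (christoffel b G l i j) z - pd b j (christoffel b G l i k) z
      + ∑ m, (christoffel b G m i j z * christoffel b G l m k z
          - christoffel b G m i k z * christoffel b G l m j z))

/-- The components of the covariant Hessian, `∇_b h_a = ∂_b ∂_a h - Γ^c_{ab} ∂_c h`. -/
def hessian (b : Module.Basis ι ℝ E) (G : E → Matrix ι ι ℝ) (h : E → ℝ) (z : E) :
    Matrix ι ι ℝ :=
  fun i j => pd b j (pd b i h) z - ∑ c, christoffel b G c i j z * pd b c h z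

/-- The trace `g^{il} R_{ijkl}`, where `A` is the inverse matrix `g^{ij}`. -/
def ricciContraction (A : Matrix ι ι ℝ) (R : ι → ι → ι → ι → ℝ) : Matrix ι ι ℝ :=
  fun j k => ∑ i, ∑ l, A i l * R i j k l

/-- The trace `g^{ab} B_{ab}`, where `A` is the inverse matrix `g^{ij}`. -/
def metricTrace (A B : Matrix ι ι ℝ) : ℝ :=
  ∑ i, ∑ j, A i j * B i j

/-- The contracted product `g^{kl} B_{ik} C_{jl}`, where `A` is the inverse matrix `g^{ij}`. For
symmetric `B` and `C` these are the components of the composition of the endomorphisms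
associated with them. -/
def contract (A B C : Matrix ι ι ℝ) : Matrix ι ι ℝ :=
  fun i j => ∑ k, ∑ l, A k l * B i k * C j l

/-- The Kulkarni-Nomizu product
`(A ∧ B)_{ijkl} = A_{il} B_{jk} + A_{jk} B_{il} - A_{ik} B_{jl} - A_{jl} B_{ik}`. -/
def kulkarniNomizu (A B : Matrix ι ι ℝ) (i j k l : ι) : ℝ :=
  A i l * B j k + A j k * B i l - A i k * B j l - A j l * B i k

end Coordinates

/-! ### Semi-Riemannian manifolds -/

section Manifolds

variable {E : Type*} [NormedAddCommGroup E] [NormedSpace ℝ E]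
  {H : Type*} [TopologicalSpace H] (I : ModelWithCorners ℝ E H)
  (M : Type*) [TopologicalSpace M] [ChartedSpace H M] [IsManifold I ∞ M]

/-- A semi-Riemannian metric on a smooth manifold: a symmetric nondegenerate bilinear form on every
tangent space, depending smoothly on the point. Smoothness says that the components are smooth in
the preferred charts (these cover `M`): `tangentCoordChange I x₀ q q u` is the tangent vector
at `q` with constant coordinates `u` in the chart at `x₀`. (On a connected manifold the
index of such a form is constant.) -/
structure SemiRiemannianMetric where
  val : ∀ x : M, TangentSpace I x →ₗ[ℝ] TangentSpace I x →ₗ[ℝ] ℝ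
  symm : ∀ x u v, val x u v = val x v u
  nondegenerate : ∀ x u, (∀ v, val x u v = 0) → u = 0
  smooth : ∀ (x₀ : M) (u v : E),
    ContDiffOn ℝ ∞
      (fun z : E =>
        val ((extChartAt I x₀).symm z)
          (tangentCoordChange I x₀ ((extChartAt I x₀).symm z) ((extChartAt I x₀).symm z) u)
          (tangentCoordChange I x₀ ((extChartAt I x₀).symm z) ((extChartAt I x₀).symm z) v))
      (extChartAt I x₀).target

namespace SemiRiemannianMetric

variable {I M} {ι : Type*} [Fintype ι] [DecidableEq ι]
  (g : SemiRiemannianMetric I M) (b : Module.Basis ι ℝ E)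

/-- The components `g_{ij}` of the metric in the chart at `x₀`, as functions of the coordinates. -/
def coord (x₀ : M) (z : E) : Matrix ι ι ℝ := fun i j =>
  g.val ((extChartAt I x₀).symm z)
    (tangentCoordChange I x₀ ((extChartAt I x₀).symm z) ((extChartAt I x₀).symm z) (b i))
    (tangentCoordChange I x₀ ((extChartAt I x₀).symm z) ((extChartAt I x₀).symm z) (b j))

/-! All tensors at a point `x` are given by their components with respect to the coordinate
basis of the tangent space at `x` that belongs to the chart at `x` and the basis `b`. -/

/-- The metric `g_{ij}` at `x`. -/
def metric (x : M) : Matrix ι ι ℝ := g.coord b x (extChartAt I x x)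

/-- The inverse metric `g^{ij}` at `x`. -/
def inv (x : M) : Matrix ι ι ℝ := (g.metric b x)⁻¹

/-- The Riemann-Christoffel curvature tensor `R` of type `(0,4)` at `x`. -/
def curvature (x : M) : ι → ι → ι → ι → ℝ := riemann b (g.coord b x) (extChartAt I x x)

/-- The Ricci tensor `S_{jk} = g^{il} R_{ijkl}` at `x`. -/
def ricci (x : M) : Matrix ι ι ℝ := ricciContraction (g.inv b x) (g.curvature b x)

/-- The Ricci tensor of level 2, `S²_{ij} = g^{kl} S_{ik} S_{jl}`, at `x`. -/
def ricciSq (x : M) : Matrix ι ι ℝ := contract (g.inv b x) (g.ricci b x) (g.ricci b x)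

/-- The coordinate expression `z ↦ f (φ⁻¹ z)` of a function in the chart `φ` at `x`. -/
def _root_.WarpedRoter.localRep (I : ModelWithCorners ℝ E H) (f : M → ℝ) (x : M) (z : E) : ℝ :=
  f ((extChartAt I x).symm z)

/-- The components `f_a = ∂_a f` of the differential of `f` at `x`. -/
def diff (f : M → ℝ) (x : M) : ι → ℝ :=
  fun a => pd b a (localRep I f x) (extChartAt I x x)

/-- `T_{ab} = -(1/(2f)) (∇_b f_a - (1/(2f)) f_a f_b)` at `x`. -/
def tensorT (f : M → ℝ) (x : M) : Matrix ι ι ℝ := fun a c =>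
  -(1 / (2 * f x)) * (hessian b (g.coord b x) (localRep I f x) (extChartAt I x x) a c
    - (1 / (2 * f x)) * (diff (I := I) b f x a * diff (I := I) b f x c))

/-- `T²_{ac} = g^{kl} T_{ak} T_{cl}` at `x`. -/
def tensorTSq (f : M → ℝ) (x : M) : Matrix ι ι ℝ :=
  contract (g.inv b x) (g.tensorT b f x) (g.tensorT b f x)

/-- The symmetric product `(S·T)_{ac} = g^{kl} (S_{ak} T_{cl} + T_{ak} S_{cl})` at `x`. -/
def tensorST (f : M → ℝ) (x : M) : Matrix ι ι ℝ :=
  contract (g.inv b x) (g.ricci b x) (g.tensorT b f x)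
    + contract (g.inv b x) (g.tensorT b f x) (g.ricci b x)

/-- `P = (1/(4f²)) g^{ab} f_a f_b` at `x`. -/
def scalarP (f : M → ℝ) (x : M) : ℝ :=
  1 / (4 * f x ^ 2) *
    ∑ a, ∑ c, g.inv b x a c * diff (I := I) b f x a * diff (I := I) b f x c

/-- `Q = f (tr T - (q - 1) P)` at `x`, where `q` is the dimension of the fiber. -/
def scalarQ (q : ℕ) (f : M → ℝ) (x : M) : ℝ :=
  f x * (metricTrace (g.inv b x) (g.tensorT b f x) - ((q : ℝ) - 1) * g.scalarP b f x)

/-- The generalized Roter type condition with the associated scalars `L₁, …, L₆`: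
`R = L₁ g∧g + L₂ g∧S + L₃ S∧S + L₄ g∧S² + L₅ S∧S² + L₆ S²∧S²` at every point. -/
def IsGeneralizedRoterTypeWith (L₁ L₂ L₃ L₄ L₅ L₆ : M → ℝ) : Prop :=
  ∀ (x : M) (i j k l : ι),
    g.curvature b x i j k l
      = L₁ x * kulkarniNomizu (g.metric b x) (g.metric b x) i j k l
        + L₂ x * kulkarniNomizu (g.metric b x) (g.ricci b x) i j k l
        + L₃ x * kulkarniNomizu (g.ricci b x) (g.ricci b x) i j k l
        + L₄ x * kulkarniNomizu (g.metric b x) (g.ricciSq b x) i j k l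
        + L₅ x * kulkarniNomizu (g.ricci b x) (g.ricciSq b x) i j k l
        + L₆ x * kulkarniNomizu (g.ricciSq b x) (g.ricciSq b x) i j k l

end SemiRiemannianMetric

end Manifolds

/-! ### Warped products -/

section Warped

variable {E : Type*} [NormedAddCommGroup E] [NormedSpace ℝ E]
  {H : Type*} [TopologicalSpace H] {I : ModelWithCorners ℝ E H}
  {B : Type*} [TopologicalSpace B] [ChartedSpace H B] [IsManifold I ∞ B]
  {E' : Type*} [NormedAddCommGroup E'] [NormedSpace ℝ E']
  {H' : Type*} [TopologicalSpace H'] {I' : ModelWithCorners ℝ E' H'}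
  {F : Type*} [TopologicalSpace F] [ChartedSpace H' F] [IsManifold I' ∞ F]

theorem tangentCoordChange_prod_apply (x₀ q : B × F)
    (hq : q ∈ (extChartAt (I.prod I') x₀).source) (u : E × E') :
    tangentCoordChange (I.prod I') x₀ q q u
      = (tangentCoordChange I x₀.1 q.1 q.1 u.1, tangentCoordChange I' x₀.2 q.2 q.2 u.2) := by
  have hq' := hq
  rw [extChartAt_prod, PartialEquiv.prod_source] at hq'
  have h1 := hasFDerivWithinAt_tangentCoordChange (I := I) (x := x₀.1) (y := q.1) (z := q.1)
    ⟨hq'.1, mem_extChartAt_source q.1⟩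
  have h2 := hasFDerivWithinAt_tangentCoordChange (I := I') (x := x₀.2) (y := q.2) (z := q.2)
    ⟨hq'.2, mem_extChartAt_source q.2⟩
  have h := hasFDerivWithinAt_tangentCoordChange (I := I.prod I') (x := x₀) (y := q) (z := q)
    ⟨hq, mem_extChartAt_source q⟩
  have hr : Set.range (I.prod I') = Set.range I ×ˢ Set.range I' := by
    rw [modelWithCorners_prod_coe, Set.range_prodMap]
  have h3 : HasFDerivWithinAt (extChartAt (I.prod I') q ∘ (extChartAt (I.prod I') x₀).symm)
      ((tangentCoordChange I x₀.1 q.1 q.1).prodMap (tangentCoordChange I' x₀.2 q.2 q.2))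
      (Set.range (I.prod I')) (extChartAt (I.prod I') x₀ q) := by
    have hc : (extChartAt (I.prod I') q ∘ (extChartAt (I.prod I') x₀).symm : E × E' → E × E')
        = Prod.map (extChartAt I q.1 ∘ (extChartAt I x₀.1).symm)
          (extChartAt I' q.2 ∘ (extChartAt I' x₀.2).symm) := by
      rw [extChartAt_prod, extChartAt_prod]
      rfl
    have hp : extChartAt (I.prod I') x₀ q = (extChartAt I x₀.1 q.1, extChartAt I' x₀.2 q.2) := by
      rw [extChartAt_prod]
      rfl
    rw [hr, hc, hp]
    exact HasFDerivWithinAt.prodMap (p := (extChartAt I x₀.1 q.1, extChartAt I' x₀.2 q.2))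
      (h1.mono (by rintro _ ⟨z, hz, rfl⟩; exact hz.1))
      (h2.mono (by rintro _ ⟨z, hz, rfl⟩; exact hz.2))
  have hu : UniqueDiffWithinAt ℝ (Set.range (I.prod I')) (extChartAt (I.prod I') x₀ q) :=
    (I.prod I').uniqueDiffOn _ (by rw [extChartAt_coe]; exact Set.mem_range_self _)
  have := hu.eq h h3
  rw [this]
  rfl

/-- The bilinear form `β₁(u₁, v₁) + c β₂(u₂, v₂)` on `V × W`. -/
def prodForm {V W : Type*} [AddCommGroup V] [Module ℝ V] [AddCommGroup W] [Module ℝ W]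
    (β₁ : V →ₗ[ℝ] V →ₗ[ℝ] ℝ) (c : ℝ) (β₂ : W →ₗ[ℝ] W →ₗ[ℝ] ℝ) :
    (V × W) →ₗ[ℝ] (V × W) →ₗ[ℝ] ℝ :=
  LinearMap.mk₂ ℝ (fun u v => β₁ u.1 v.1 + c * β₂ u.2 v.2)
    (by intro u u' v
        simp only [Prod.fst_add, Prod.snd_add, map_add, LinearMap.add_apply]; ring)
    (by intro a u v
        simp only [Prod.smul_fst, Prod.smul_snd, map_smul, LinearMap.smul_apply, smul_eq_mul]; ring)
    (by intro u v v'
        simp only [Prod.fst_add, Prod.snd_add, map_add]; ring)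
    (by intro a u v
        simp only [Prod.smul_fst, Prod.smul_snd, map_smul, smul_eq_mul]; ring)

/-- The warped product metric `π^* g₁ + (f ∘ π) σ^* g₂` on `B × F`; the tangent space of
`B × F` at `(x, y)` is the product of the tangent spaces, and the differentials of the two
projections are the projections of this product. -/
def warpedMetric (g₁ : SemiRiemannianMetric I B) (g₂ : SemiRiemannianMetric I' F)
    (f : B → ℝ) (hf : ContMDiff I 𝓘(ℝ, ℝ) ∞ f) (hpos : ∀ x, 0 < f x) :
    SemiRiemannianMetric (I.prod I') (B × F) where
  val q := prodForm (V := TangentSpace I q.1) (W := TangentSpace I' q.2)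
    (g₁.val q.1) (f q.1) (g₂.val q.2)
  symm q u v := by
    change g₁.val q.1 _ _ + f q.1 * g₂.val q.2 _ _ = g₁.val q.1 _ _ + f q.1 * g₂.val q.2 _ _
    rw [g₁.symm, g₂.symm]
  nondegenerate q u h := by
    change ∀ v : TangentSpace I q.1 × TangentSpace I' q.2,
      g₁.val q.1 u.1 v.1 + f q.1 * g₂.val q.2 u.2 v.2 = 0 at h
    refine Prod.ext (g₁.nondegenerate q.1 _ fun v => ?_) (g₂.nondegenerate q.2 _ fun v => ?_)
    · have := h (v, 0)
      rwa [map_zero, mul_zero, add_zero] at this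
    · have := h (0, v)
      rw [map_zero, zero_add] at this
      exact (mul_eq_zero.1 this).resolve_left (hpos _).ne'
  smooth x₀ u v := by
    have hfs : ContDiffOn ℝ ∞ (fun z => f ((extChartAt I x₀.1).symm z))
        (extChartAt I x₀.1).target :=
      contMDiffOn_iff_contDiffOn.1 (hf.comp_contMDiffOn (contMDiffOn_extChartAt_symm x₀.1))
    have ht : (extChartAt (I.prod I') x₀).target
        = (extChartAt I x₀.1).target ×ˢ (extChartAt I' x₀.2).target := by
      rw [extChartAt_prod, PartialEquiv.prod_target]
    have m1 : Set.MapsTo (Prod.fst : E × E' → E) (extChartAt (I.prod I') x₀).target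
        (extChartAt I x₀.1).target := by
      rw [ht]; exact fun z hz => hz.1
    have m2 : Set.MapsTo (Prod.snd : E × E' → E') (extChartAt (I.prod I') x₀).target
        (extChartAt I' x₀.2).target := by
      rw [ht]; exact fun z hz => hz.2
    refine ContDiffOn.congr
      (((g₁.smooth x₀.1 u.1 v.1).comp contDiff_fst.contDiffOn m1).add
        ((hfs.comp contDiff_fst.contDiffOn m1).mul
          ((g₂.smooth x₀.2 u.2 v.2).comp contDiff_snd.contDiffOn m2))) ?_
    intro z hz
    have hs := (extChartAt (I.prod I') x₀).map_target hz
    have e : (extChartAt (I.prod I') x₀).symm z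
        = ((extChartAt I x₀.1).symm z.1, (extChartAt I' x₀.2).symm z.2) := by
      rw [extChartAt_prod]; rfl
    have a := tangentCoordChange_prod_apply (I := I) (I' := I') x₀ _ hs u
    have a' := tangentCoordChange_prod_apply (I := I) (I' := I') x₀ _ hs v
    change g₁.val _ (tangentCoordChange (I.prod I') x₀ _ _ u).1
        (tangentCoordChange (I.prod I') x₀ _ _ v).1
      + f _ * g₂.val _ (tangentCoordChange (I.prod I') x₀ _ _ u).2
        (tangentCoordChange (I.prod I') x₀ _ _ v).2 = _
    rw [a, a', e]
    rfl

end Warped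

/-! ### The tables of coefficients -/

section Tables

variable (q : ℕ) (f P Q L₁ L₂ L₃ L₄ L₅ L₆ : ℝ)

/-- Coefficients with respect to `ḡ, S̄, S̄², T, T², S̄·T` (rows and columns). -/
def baseTable : Matrix (Fin 6) (Fin 6) ℝ :=
  let m : ℝ := q
  !![L₁, L₂ / 2, L₄ / 2, m * L₂ / 2, m ^ 2 * L₄ / 2, m * L₄ / 2;
    L₂ / 2, L₃, L₅ / 2, m * L₃, m ^ 2 * L₅ / 2, m * L₅ / 2;
    L₄ / 2, L₅ / 2, L₆, m * L₅ / 2, m ^ 2 * L₆, m * L₆;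
    m * L₂ / 2, m * L₃, m * L₅ / 2, m ^ 2 * L₃, m ^ 3 * L₅ / 2, m ^ 2 * L₅ / 2;
    m ^ 2 * L₄ / 2, m ^ 2 * L₅ / 2, m ^ 2 * L₆, m ^ 3 * L₅ / 2, m ^ 4 * L₆, m ^ 3 * L₆;
    m * L₄ / 2, m * L₅ / 2, m * L₆, m ^ 2 * L₅ / 2, m ^ 3 * L₆, m ^ 2 * L₆]

/-- Coefficients with respect to `ḡ, S̄, S̄², T, T², S̄·T` (rows) and `g̃, S̃, S̃²` (columns). -/
def mixedTable : Matrix (Fin 6) (Fin 3) ℝ :=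
  let m : ℝ := q
  !![-(L₄ * Q ^ 2 / f) - L₂ * Q - 2 * f * L₁, -L₂ - 2 * L₄ * Q / f, -(L₄ / f);
    -(L₅ * Q ^ 2 / f) - 2 * L₃ * Q - f * L₂, -(2 * (f * L₃ + L₅ * Q) / f), -(L₅ / f);
    -(2 * L₆ * Q ^ 2 / f) - L₅ * Q - f * L₄, -L₅ - 4 * L₆ * Q / f, -(2 * L₆ / f);
    f * (1 - m * L₂) - m * L₅ * Q ^ 2 / f - 2 * m * L₃ * Q,
      -(2 * m * (f * L₃ + L₅ * Q) / f), -(m * L₅ / f);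
    -(m ^ 2 * (L₄ * f ^ 2 + L₅ * Q * f + 2 * L₆ * Q ^ 2) / f),
      -(m ^ 2 * (f * L₅ + 4 * L₆ * Q) / f), -(2 * m ^ 2 * L₆ / f);
    -(m * (L₄ * f ^ 2 + L₅ * Q * f + 2 * L₆ * Q ^ 2) / f),
      -(m * (f * L₅ + 4 * L₆ * Q) / f), -(2 * m * L₆ / f)]

/-- Coefficients with respect to `g̃, S̃, S̃²` (rows and columns). -/
def fiberTable : Matrix (Fin 3) (Fin 3) ℝ :=
  let gg : ℝ := L₆ * Q ^ 4 / f ^ 2 + L₅ * Q ^ 3 / f + (L₃ + L₄) * Q ^ 2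
    + f * L₂ * Q + f ^ 2 * L₁ + f ^ 2 * P / 2
  let gS : ℝ := (L₃ + L₄) * Q
    + (L₂ * f ^ 3 + 3 * L₅ * Q ^ 2 * f + 4 * L₆ * Q ^ 3) / (2 * f ^ 2)
  let gS2 : ℝ := (L₄ + Q * (f * L₅ + 2 * L₆ * Q) / f ^ 2) / 2
  let SS : ℝ := L₃ + 2 * Q * (f * L₅ + 2 * L₆ * Q) / f ^ 2
  let SS2 : ℝ := (f * L₅ + 4 * L₆ * Q) / (2 * f ^ 2)
  !![gg, gS, gS2;
    gS, SS, SS2;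
    gS2, SS2, L₆ / f ^ 2]

end Tables

/-! ### The three conditions

The base `B` and the fiber `F` have dimensions `p` and `q`, and Cartesian coordinates are used. -/

section Conditions

variable {p q : ℕ}
  {B : Type*} [TopologicalSpace B]
  [ChartedSpace (EuclideanSpace ℝ (Fin p)) B] [IsManifold (𝓡 p) ∞ B]
  {F : Type*} [TopologicalSpace F]
  [ChartedSpace (EuclideanSpace ℝ (Fin q)) F] [IsManifold (𝓡 q) ∞ F]

/-- The standard basis of `ℝⁿ`. -/
def stdBasis (n : ℕ) : Module.Basis (Fin n) ℝ (EuclideanSpace ℝ (Fin n)) :=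
  (EuclideanSpace.basisFun (Fin n) ℝ).toBasis

/-- The tensors `ḡ, S̄, S̄², T, T², S̄·T` at a point of the base. -/
def baseTensors (gB : SemiRiemannianMetric (𝓡 p) B) (f : B → ℝ) (x : B) :
    Fin 6 → Matrix (Fin p) (Fin p) ℝ :=
  ![gB.metric (stdBasis p) x, gB.ricci (stdBasis p) x, gB.ricciSq (stdBasis p) x,
    gB.tensorT (stdBasis p) f x, gB.tensorTSq (stdBasis p) f x, gB.tensorST (stdBasis p) f x]

/-- The tensors `g̃, S̃, S̃²` at a point of the fiber. -/
def fiberTensors (gF : SemiRiemannianMetric (𝓡 q) F) (y : F) :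
    Fin 3 → Matrix (Fin q) (Fin q) ℝ :=
  ![gF.metric (stdBasis q) y, gF.ricci (stdBasis q) y, gF.ricciSq (stdBasis q) y]

/-- The curvature tensor of the base is the Kulkarni-Nomizu quadratic form given by
`baseTable`. -/
def BaseCondition (gB : SemiRiemannianMetric (𝓡 p) B) (q : ℕ) (f : B → ℝ) (x : B)
    (L₁ L₂ L₃ L₄ L₅ L₆ : ℝ) : Prop :=
  ∀ a b c d : Fin p, gB.curvature (stdBasis p) x a b c d =
    ∑ r, ∑ s, baseTable q L₁ L₂ L₃ L₄ L₅ L₆ r s *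
      kulkarniNomizu (baseTensors gB f x r) (baseTensors gB f x s) a b c d

/-- The mixed expression given by `mixedTable` vanishes. -/
def MixedCondition (gB : SemiRiemannianMetric (𝓡 p) B) (gF : SemiRiemannianMetric (𝓡 q) F)
    (f : B → ℝ) (x : B) (y : F) (L₁ L₂ L₃ L₄ L₅ L₆ : ℝ) : Prop :=
  ∀ (a b : Fin p) (α β : Fin q),
    ∑ r, ∑ s,
      mixedTable q (f x) (gB.scalarQ (stdBasis p) q f x) L₁ L₂ L₃ L₄ L₅ L₆ r s *
        (baseTensors gB f x r a b * fiberTensors gF y s α β) = 0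

/-- `f` times the curvature tensor of the fiber is the Kulkarni-Nomizu quadratic form given by
`fiberTable`. -/
def FiberCondition (gB : SemiRiemannianMetric (𝓡 p) B) (gF : SemiRiemannianMetric (𝓡 q) F)
    (f : B → ℝ) (x : B) (y : F) (L₁ L₂ L₃ L₄ L₅ L₆ : ℝ) : Prop :=
  ∀ α β γ δ : Fin q, f x * gF.curvature (stdBasis q) y α β γ δ =
    ∑ r, ∑ s,
      fiberTable (f x) (gB.scalarP (stdBasis p) f x) (gB.scalarQ (stdBasis p) q f x)
          L₁ L₂ L₃ L₄ L₅ L₆ r s *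
        kulkarniNomizu (fiberTensors gF y r) (fiberTensors gF y s) α β γ δ

end Conditions

end WarpedRoter

end

/-!
In product coordinates the metric matrix of `B ×_f F` is block diagonal, and a computation with
Christoffel symbols of the first kind shows that the only components of its curvature tensor, up
to symmetries, are `R̄` on the base, `T ⊗ f g̃` in the mixed positions, and
`f R̃ - (f² P / 2) g̃ ∧ g̃` on the fiber. Contracting, `S` and `S²` are block diagonal too: the
base blocks of `(g, S, S²)` are `M V` for a constant `3 × 6` matrix `M`, and the fiber blocks are
`N W` for a `3 × 3` matrix `N` depending on `f` and `Q`.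

The Roter form is a quadratic form `∑ L_{rs} U_r ∧ U_s` in `U = (g, S, S²)`. On block diagonal
tensors it splits into a base part, a fiber part, and twice the associated bilinear form in the
mixed positions, with the matrices `Mᵀ L M`, `Nᵀ L N` and `Mᵀ L N`. Comparing blocks with the
curvature tensor gives the three conditions: the table `A` is `Mᵀ L M`, while `B` and `C` are
`-2 Mᵀ L N` and `Nᵀ L N` corrected in one entry by the terms with `T` and `P` of the curvature
tensor itself.
-/

namespace WarpedRoter

open Filter Topology

/-! ### The curvature tensor in coordinates -/

section PartialDerivatives

variable {ι κ : Type*} {E : Type*} [NormedAddCommGroup E] [NormedSpace ℝ E]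
  {E' : Type*} [NormedAddCommGroup E'] [NormedSpace ℝ E'] (b : Module.Basis ι ℝ E)

theorem pd_congr {h k : E → ℝ} {z : E} (e : h =ᶠ[𝓝 z] k) (i : ι) :
    pd b i h z = pd b i k z := by
  rw [pd, pd, e.fderiv_eq]

theorem pd_zero (i : ι) (z : E) : pd b i (fun _ => 0) z = 0 := by
  rw [pd, fderiv_fun_const, Pi.zero_apply, zero_apply]

theorem pd_mul {h k : E → ℝ} {z : E} (hh : DifferentiableAt ℝ h z)
    (hk : DifferentiableAt ℝ k z) (i : ι) :
    pd b i (fun w => h w * k w) z = pd b i h z * k z + h z * pd b i k z := by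
  simp only [pd, fderiv_fun_mul hh hk, add_apply, smul_apply, smul_eq_mul]
  ring

theorem pd_const_mul {h : E → ℝ} {z : E} (hh : DifferentiableAt ℝ h z) (c : ℝ) (i : ι) :
    pd b i (fun w => c * h w) z = c * pd b i h z := by
  simp only [pd, fderiv_const_mul hh c, smul_apply, smul_eq_mul]

theorem pd_add {h k : E → ℝ} {z : E} (hh : DifferentiableAt ℝ h z)
    (hk : DifferentiableAt ℝ k z) (i : ι) :
    pd b i (fun w => h w + k w) z = pd b i h z + pd b i k z := by
  simp only [pd, fderiv_fun_add hh hk, add_apply]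

theorem pd_sub {h k : E → ℝ} {z : E} (hh : DifferentiableAt ℝ h z)
    (hk : DifferentiableAt ℝ k z) (i : ι) :
    pd b i (fun w => h w - k w) z = pd b i h z - pd b i k z := by
  simp only [pd, fderiv_fun_sub hh hk, sub_apply]

theorem pd_sum [Fintype κ] {h : κ → E → ℝ} {z : E} (hh : ∀ l, DifferentiableAt ℝ (h l) z)
    (i : ι) : pd b i (fun w => ∑ l, h l w) z = ∑ l, pd b i (h l) z := by
  simp only [pd, fderiv_fun_sum fun l _ => hh l, sum_apply]

theorem contDiffAt_pd {h : E → ℝ} {z : E} (hh : ContDiffAt ℝ 2 h z) (i : ι) :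
    ContDiffAt ℝ 1 (pd b i h) z :=
  (hh.fderiv_right (m := 1) (by norm_num)).clm_apply contDiffAt_const

theorem pd_comm {h : E → ℝ} {z : E} (hh : ContDiffAt ℝ 2 h z) (i j : ι) :
    pd b i (pd b j h) z = pd b j (pd b i h) z := by
  have hd : DifferentiableAt ℝ (fderiv ℝ h) z :=
    (hh.fderiv_right (m := 1) (by norm_num)).differentiableAt one_ne_zero
  have pd_pd (k l : ι) : pd b k (pd b l h) z = fderiv ℝ (fderiv ℝ h) z (b k) (b l) := by
    change fderiv ℝ (fun w => fderiv ℝ h w (b l)) z (b k) = _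
    rw [(hd.hasFDerivAt.clm_apply (hasFDerivAt_const (b l) z)).fderiv]
    simp
  rw [pd_pd, pd_pd]
  exact (hh.isSymmSndFDerivAt (by rw [minSmoothness_of_isRCLikeNormedField])).eq _ _

variable (b' : Module.Basis κ ℝ E')

theorem pd_prod_mul {h : E → ℝ} {k : E' → ℝ} {z : E × E'} (hh : DifferentiableAt ℝ h z.1)
    (hk : DifferentiableAt ℝ k z.2) (c : ι ⊕ κ) :
    pd (b.prod b') c (fun w => h w.1 * k w.2) z
      = Sum.elim (fun i => pd b i h z.1 * k z.2) (fun j => h z.1 * pd b' j k z.2) c := by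
  have hd := ((hh.hasFDerivAt.comp z hasFDerivAt_fst).mul
    (hk.hasFDerivAt.comp z hasFDerivAt_snd)).fderiv
  change fderiv ℝ ((h ∘ Prod.fst) * (k ∘ Prod.snd)) z _ = _
  rw [hd]
  cases c <;> simp [pd, mul_comm]

theorem pd_prod_fst {h : E → ℝ} {z : E × E'} (hh : DifferentiableAt ℝ h z.1) (c : ι ⊕ κ) :
    pd (b.prod b') c (fun w => h w.1) z = Sum.elim (fun i => pd b i h z.1) 0 c := by
  rw [pd, show (fun w : E × E' => h w.1) = h ∘ Prod.fst from rfl,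
    (hh.hasFDerivAt.comp z hasFDerivAt_fst).fderiv]
  cases c <;> simp [pd]

end PartialDerivatives

section Metrics

variable {ι : Type*} [Fintype ι]

theorem dotProduct_mulVec_comm {A : Matrix ι ι ℝ} (hA : A.IsSymm) (v w : ι → ℝ) :
    v ⬝ᵥ (A *ᵥ w) = w ⬝ᵥ (A *ᵥ v) := by
  rw [Matrix.dotProduct_mulVec, ← Matrix.mulVec_transpose, hA.eq, dotProduct_comm]

variable [DecidableEq ι]
  {E : Type*} [NormedAddCommGroup E] [NormedSpace ℝ E]

/-- The components of a semi-Riemannian metric of class `C²` near the point with coordinates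
`z`. Nondegeneracy is an open condition, so it is only required at `z` itself. -/
structure IsMetricAt (G : E → Matrix ι ι ℝ) (z : E) : Prop where
  symm : ∀ᶠ w in 𝓝 z, (G w).IsSymm
  isUnit_det : IsUnit (G z).det
  contDiffAt : ∀ i j, ContDiffAt ℝ 2 (fun w => G w i j) z

/-- The Christoffel symbols of the first kind `Γ_{ij,l} = g_{lm} Γ^m_{ij}`, as the covector with
index `l`. -/
noncomputable def christoffelFirst (b : Module.Basis ι ℝ E) (G : E → Matrix ι ι ℝ) (i j : ι)
    (z : E) : ι → ℝ := fun l =>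
  (1 / 2) *
    (pd b i (fun w => G w j l) z + pd b j (fun w => G w i l) z - pd b l (fun w => G w i j) z)

theorem christoffel_eq_mulVec (b : Module.Basis ι ℝ E) (G : E → Matrix ι ι ℝ) (k i j : ι)
    (z : E) : christoffel b G k i j z = ((G z)⁻¹ *ᵥ christoffelFirst b G i j z) k := by
  simp only [christoffel, christoffelFirst, Matrix.mulVec, dotProduct, Finset.mul_sum]
  exact Finset.sum_congr rfl fun l _ => by ring

theorem hessian_eq (b : Module.Basis ι ℝ E) (G : E → Matrix ι ι ℝ) (h : E → ℝ) (z : E)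
    (i j : ι) : hessian b G h z i j
      = pd b j (pd b i h) z
        - ((G z)⁻¹ *ᵥ christoffelFirst b G i j z) ⬝ᵥ fun c => pd b c h z := by
  simp only [hessian, christoffel_eq_mulVec, dotProduct]

theorem christoffel_congr (b : Module.Basis ι ℝ E) {G G' : E → Matrix ι ι ℝ} {z : E}
    (e : G =ᶠ[𝓝 z] G') (k i j : ι) : christoffel b G k i j =ᶠ[𝓝 z] christoffel b G' k i j := by
  filter_upwards [e.eventually_nhds] with w hw
  have entry (i j : ι) : (fun v => G v i j) =ᶠ[𝓝 w] fun v => G' v i j :=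
    hw.mono fun v hv => congrFun (congrFun hv i) j
  simp only [christoffel, pd_congr b (entry _ _), hw.self_of_nhds]

theorem riemann_congr (b : Module.Basis ι ℝ E) {G G' : E → Matrix ι ι ℝ} {z : E}
    (e : G =ᶠ[𝓝 z] G') : riemann b G z = riemann b G' z := by
  funext h i j k
  simp only [riemann, pd_congr b (christoffel_congr b e _ _ _),
    (christoffel_congr b e _ _ _).self_of_nhds, e.self_of_nhds]

theorem contDiffAt_det {n : WithTop ℕ∞} {A : E → Matrix ι ι ℝ} {z : E}
    (hA : ∀ i j, ContDiffAt ℝ n (fun w => A w i j) z) :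
    ContDiffAt ℝ n (fun w => (A w).det) z := by
  simp only [Matrix.det_apply']
  exact ContDiffAt.sum fun s _ => contDiffAt_const.mul (contDiffAt_prod fun i _ => hA _ _)

theorem contDiffAt_inv_apply {n : WithTop ℕ∞} {A : E → Matrix ι ι ℝ} {z : E}
    (hA : ∀ i j, ContDiffAt ℝ n (fun w => A w i j) z) (h0 : IsUnit (A z).det) (i j : ι) :
    ContDiffAt ℝ n (fun w => (A w)⁻¹ i j) z := by
  have hadj : ContDiffAt ℝ n (fun w => (A w).adjugate i j) z := by
    simp only [Matrix.adjugate_apply]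
    refine contDiffAt_det fun k l => ?_
    by_cases h : k = j
    · subst h
      simpa using contDiffAt_const
    · simpa [Matrix.updateRow_ne h] using hA k l
  simpa [Matrix.inv_def, Ring.inverse_eq_inv'] using
    ((contDiffAt_det hA).inv h0.ne_zero).mul hadj

theorem dotProduct_inv_mulVec {A : Matrix ι ι ℝ} (hA : IsUnit A.det) (i : ι) (v : ι → ℝ) :
    A i ⬝ᵥ (A⁻¹ *ᵥ v) = v i := by
  change (A *ᵥ (A⁻¹ *ᵥ v)) i = v i
  rw [Matrix.mulVec_mulVec, Matrix.mul_nonsing_inv _ hA, Matrix.one_mulVec]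

theorem inv_isSymm {A : Matrix ι ι ℝ} (hA : A.IsSymm) : (A⁻¹).IsSymm := by
  rw [Matrix.IsSymm, Matrix.transpose_nonsing_inv, hA.eq]

theorem riemann_swap_right (b : Module.Basis ι ℝ E) (G : E → Matrix ι ι ℝ) (z : E) (h i j k : ι) :
    riemann b G z h i k j = -riemann b G z h i j k := by
  simp only [riemann, ← Finset.sum_neg_distrib, Finset.sum_sub_distrib]
  exact Finset.sum_congr rfl fun l _ => by ring

namespace IsMetricAt

variable {G : E → Matrix ι ι ℝ} {z : E} (hG : IsMetricAt G z) (b : Module.Basis ι ℝ E)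

include hG

theorem eventually : ∀ᶠ w in 𝓝 z, IsMetricAt G w := by
  have hdet := (contDiffAt_det hG.contDiffAt).continuousAt.eventually_ne hG.isUnit_det.ne_zero
  have hcd : ∀ᶠ w in 𝓝 z, ∀ i j, ContDiffAt ℝ 2 (fun v => G v i j) w :=
    eventually_all.2 fun i => eventually_all.2 fun j => (hG.contDiffAt i j).eventually (by simp)
  filter_upwards [hG.symm.eventually_nhds, hdet, hcd] with w hs hd hc
  exact ⟨hs, hd.isUnit, hc⟩

theorem differentiableAt (i j : ι) : DifferentiableAt ℝ (fun w => G w i j) z :=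
  (hG.contDiffAt i j).differentiableAt two_ne_zero

theorem pd_symm (l i j : ι) : pd b l (fun w => G w i j) z = pd b l (fun w => G w j i) z :=
  pd_congr b (hG.symm.mono fun _ hw => hw.apply j i) l

theorem differentiableAt_christoffelFirst (i j l : ι) :
    DifferentiableAt ℝ (fun w => christoffelFirst b G i j w l) z := by
  have hp (i j l : ι) : DifferentiableAt ℝ (pd b i fun w => G w j l) z :=
    (contDiffAt_pd b (hG.contDiffAt j l) i).differentiableAt one_ne_zero
  exact (((hp _ _ _).add (hp _ _ _)).sub (hp _ _ _)).const_mul _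

theorem differentiableAt_inv_mulVec {η : E → ι → ℝ}
    (hη : ∀ l, DifferentiableAt ℝ (fun w => η w l) z) (l : ι) :
    DifferentiableAt ℝ (fun w => ((G w)⁻¹ *ᵥ η w) l) z :=
  DifferentiableAt.fun_sum fun m _ =>
    ((contDiffAt_inv_apply hG.contDiffAt hG.isUnit_det l m).differentiableAt
      two_ne_zero).fun_mul (hη m)

theorem christoffelFirst_symm (i j : ι) :
    christoffelFirst b G i j z = christoffelFirst b G j i z := by
  funext l
  simp only [christoffelFirst, hG.pd_symm b l i j, add_comm]

theorem pd_eq_christoffelFirst_add (k h l : ι) :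
    pd b k (fun w => G w h l) z
      = christoffelFirst b G k h z l + christoffelFirst b G k l z h := by
  simp only [christoffelFirst, hG.pd_symm b k l h, hG.pd_symm b h k l, hG.pd_symm b l k h]
  ring

/-- `g_{hl} ∇_k η^l = ∇_k η_h`: this removes the derivatives of the inverse metric from
`R_{hijk}`. -/
theorem dotProduct_covariantDerivative {η : E → ι → ℝ}
    (hη : ∀ l, DifferentiableAt ℝ (fun w => η w l) z) (h k : ι) :
    (G z h ⬝ᵥ fun l => pd b k (fun w => ((G w)⁻¹ *ᵥ η w) l) z
        + ∑ m, ((G z)⁻¹ *ᵥ η z) m * christoffel b G l m k z)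
      = pd b k (fun w => η w h) z - christoffelFirst b G k h z ⬝ᵥ ((G z)⁻¹ *ᵥ η z) := by
  have hv := hG.differentiableAt_inv_mulVec hη
  have lower_eq : (fun w => ∑ l, G w h l * ((G w)⁻¹ *ᵥ η w) l) =ᶠ[𝓝 z] fun w => η w h :=
    hG.eventually.mono fun w hw => dotProduct_inv_mulVec hw.isUnit_det h (η w)
  have leibniz : pd b k (fun w => η w h) z
      = ∑ l, (pd b k (fun w => G w h l) z * ((G z)⁻¹ *ᵥ η z) l
        + G z h l * pd b k (fun w => ((G w)⁻¹ *ᵥ η w) l) z) := by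
    rw [← pd_congr b lower_eq, pd_sum b fun l => (hG.differentiableAt h l).fun_mul (hv l)]
    exact Finset.sum_congr rfl fun l _ => pd_mul b (hG.differentiableAt h l) (hv l) k
  have lower_christoffel (m : ι) :
      ∑ l, G z h l * christoffel b G l m k z = christoffelFirst b G k m z h := by
    simp only [christoffel_eq_mulVec]
    rw [hG.christoffelFirst_symm b k m]
    exact dotProduct_inv_mulVec hG.isUnit_det h _
  have lower_sum : ∑ l, G z h l * ∑ m, ((G z)⁻¹ *ᵥ η z) m * christoffel b G l m k z
      = ∑ m, christoffelFirst b G k m z h * ((G z)⁻¹ *ᵥ η z) m := by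
    simp only [← lower_christoffel, Finset.mul_sum, Finset.sum_mul]
    rw [Finset.sum_comm]
    exact Finset.sum_congr rfl fun m _ => Finset.sum_congr rfl fun l _ => by ring
  simp only [dotProduct, leibniz, mul_add, Finset.sum_add_distrib, lower_sum,
    hG.pd_eq_christoffelFirst_add b k h, add_mul]
  ring

theorem riemann_eq (h i j k : ι) :
    riemann b G z h i j k
      = pd b k (fun w => christoffelFirst b G i j w h) z
        - pd b j (fun w => christoffelFirst b G i k w h) z
        + christoffelFirst b G j h z ⬝ᵥ ((G z)⁻¹ *ᵥ christoffelFirst b G i k z)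
        - christoffelFirst b G k h z ⬝ᵥ ((G z)⁻¹ *ᵥ christoffelFirst b G i j z) := by
  have lower (j k : ι) := hG.dotProduct_covariantDerivative b
    (hG.differentiableAt_christoffelFirst b i j) h k
  simp only [← christoffel_eq_mulVec] at lower
  have split : riemann b G z h i j k
      = (G z h ⬝ᵥ fun l => pd b k (christoffel b G l i j) z
          + ∑ m, christoffel b G m i j z * christoffel b G l m k z)
        - (G z h ⬝ᵥ fun l => pd b j (christoffel b G l i k) z
          + ∑ m, christoffel b G m i k z * christoffel b G l m j z) := by
    simp only [riemann, dotProduct, ← Finset.sum_sub_distrib]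
    exact Finset.sum_congr rfl fun l _ => by rw [Finset.sum_sub_distrib]; ring
  rw [split, lower j k, lower k j]
  ring

theorem pd_christoffelFirst (i j k l : ι) :
    pd b k (fun w => christoffelFirst b G i j w l) z
      = (1 / 2) * (pd b k (pd b i fun w => G w j l) z + pd b k (pd b j fun w => G w i l) z
        - pd b k (pd b l fun w => G w i j) z) := by
  have hp (i j l : ι) : DifferentiableAt ℝ (pd b i fun w => G w j l) z :=
    (contDiffAt_pd b (hG.contDiffAt j l) i).differentiableAt one_ne_zero
  simp only [christoffelFirst]
  rw [pd_const_mul b (((hp _ _ _).fun_add (hp _ _ _)).fun_sub (hp _ _ _)),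
    pd_sub b ((hp _ _ _).fun_add (hp _ _ _)) (hp _ _ _), pd_add b (hp _ _ _) (hp _ _ _)]

theorem riemann_eq_second_pd (h i j k : ι) :
    riemann b G z h i j k
      = (1 / 2) * (pd b k (pd b i fun w => G w j h) z - pd b k (pd b h fun w => G w i j) z
          - pd b j (pd b i fun w => G w k h) z + pd b j (pd b h fun w => G w i k) z)
        + christoffelFirst b G j h z ⬝ᵥ ((G z)⁻¹ *ᵥ christoffelFirst b G i k z)
        - christoffelFirst b G k h z ⬝ᵥ ((G z)⁻¹ *ᵥ christoffelFirst b G i j z) := by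
  rw [hG.riemann_eq, hG.pd_christoffelFirst, hG.pd_christoffelFirst,
    pd_comm b (hG.contDiffAt i h) k j]
  ring

theorem riemann_pair_symm (h i j k : ι) :
    riemann b G z h i j k = riemann b G z j k h i := by
  have second_comm (k l i j : ι) :
      pd b k (pd b l fun w => G w i j) z = pd b l (pd b k fun w => G w i j) z :=
    pd_comm b (hG.contDiffAt i j) k l
  have second_symm (k l i j : ι) :
      pd b k (pd b l fun w => G w i j) z = pd b k (pd b l fun w => G w j i) z :=
    pd_congr b (hG.eventually.mono fun w hw => hw.pd_symm b l i j) k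
  have inv_symm := inv_isSymm hG.symm.self_of_nhds
  rw [hG.riemann_eq_second_pd, hG.riemann_eq_second_pd, second_comm k i, second_comm k h,
    second_comm j i, second_comm j h, second_symm i k j h, second_symm h j i k,
    hG.christoffelFirst_symm b h j, hG.christoffelFirst_symm b k i,
    dotProduct_mulVec_comm inv_symm (christoffelFirst b G i j z)]
  ring

theorem riemann_swap_left (h i j k : ι) : riemann b G z h i j k = -riemann b G z i h j k := by
  rw [hG.riemann_pair_symm, riemann_swap_right, hG.riemann_pair_symm b j k i h]

theorem riemann_swap_swap (h i j k : ι) : riemann b G z h i j k = riemann b G z i h k j := by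
  rw [hG.riemann_swap_left, riemann_swap_right, neg_neg]

theorem ricciContraction_isSymm :
    (ricciContraction (G z)⁻¹ (riemann b G z)).IsSymm := by
  ext j k
  simp only [Matrix.transpose_apply, ricciContraction]
  rw [Finset.sum_comm]
  refine Finset.sum_congr rfl fun l _ => Finset.sum_congr rfl fun i _ => ?_
  rw [(inv_isSymm hG.symm.self_of_nhds).apply, hG.riemann_pair_symm, hG.riemann_swap_swap]

end IsMetricAt

end Metrics

/-! ### The curvature tensor of a warped product metric in coordinates -/

section WarpedCoordinates

variable {ι κ : Type*} {E : Type*} {E' : Type*}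

/-- The components of the warped product metric `g₁ + φ g₂`. -/
def warpedMatrix (g₁ : E → Matrix ι ι ℝ) (φ : E → ℝ) (g₂ : E' → Matrix κ κ ℝ) (z : E × E') :
    Matrix (ι ⊕ κ) (ι ⊕ κ) ℝ :=
  Matrix.fromBlocks (g₁ z.1) 0 0 (φ z.1 • g₂ z.2)

variable [NormedAddCommGroup E] [NormedSpace ℝ E] [NormedAddCommGroup E'] [NormedSpace ℝ E']

section

variable (b : Module.Basis ι ℝ E) (b' : Module.Basis κ ℝ E') (g₁ : E → Matrix ι ι ℝ)
  (φ : E → ℝ) (g₂ : E' → Matrix κ κ ℝ) (z : E × E') (c : ι ⊕ κ) (i : ι) (j : κ)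

theorem pd_warpedMatrix_inl_inr :
    pd (b.prod b') c (fun w => warpedMatrix g₁ φ g₂ w (.inl i) (.inr j)) z = 0 :=
  pd_zero _ c z

theorem pd_warpedMatrix_inr_inl :
    pd (b.prod b') c (fun w => warpedMatrix g₁ φ g₂ w (.inr j) (.inl i)) z = 0 :=
  pd_zero _ c z

end

variable [Fintype ι] [DecidableEq ι] [Fintype κ] [DecidableEq κ]

theorem inv_fromBlocks_diag_smul {A : Matrix ι ι ℝ} {D : Matrix κ κ ℝ} {c : ℝ}
    (hA : IsUnit A.det) (hD : IsUnit D.det) (hc : c ≠ 0) :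
    (Matrix.fromBlocks A 0 0 (c • D))⁻¹ = Matrix.fromBlocks A⁻¹ 0 0 (c⁻¹ • D⁻¹) := by
  refine Matrix.inv_eq_right_inv ?_
  rw [Matrix.fromBlocks_multiply]
  simp [Matrix.mul_nonsing_inv _ hA, Matrix.mul_nonsing_inv _ hD, hc]

/-- The data of a warped product near `z`: two metrics and a nonvanishing warping function,
of class `C²`. -/
structure IsWarpedAt (g₁ : E → Matrix ι ι ℝ) (φ : E → ℝ) (g₂ : E' → Matrix κ κ ℝ)
    (z : E × E') : Prop where
  base : IsMetricAt g₁ z.1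
  fiber : IsMetricAt g₂ z.2
  contDiffAt : ContDiffAt ℝ 2 φ z.1
  ne_zero : φ z.1 ≠ 0

/-- The tensor `T` of the warping function `φ` in coordinates. -/
noncomputable def warpingTensor (b : Module.Basis ι ℝ E) (G : E → Matrix ι ι ℝ) (φ : E → ℝ)
    (z : E) : Matrix ι ι ℝ := fun a c =>
  -(1 / (2 * φ z)) * (hessian b G φ z a c - (1 / (2 * φ z)) * (pd b a φ z * pd b c φ z))

/-- The scalar `P` of the warping function `φ` in coordinates. -/
noncomputable def warpingScalar (b : Module.Basis ι ℝ E) (G : E → Matrix ι ι ℝ) (φ : E → ℝ)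
    (z : E) : ℝ :=
  1 / (4 * φ z ^ 2) * ((fun a => pd b a φ z) ⬝ᵥ ((G z)⁻¹ *ᵥ fun a => pd b a φ z))

/-- The tensor of curvature type on a product with components `A` on the base, `D` on the fiber
and `m a b α β` in the positions `a α β b`; the components with an odd number of base indices
and those in the positions `a b α β` vanish. -/
def blockCurvature (A : ι → ι → ι → ι → ℝ) (m : ι → ι → κ → κ → ℝ) (D : κ → κ → κ → κ → ℝ) :
    ι ⊕ κ → ι ⊕ κ → ι ⊕ κ → ι ⊕ κ → ℝ
  | .inl i, .inl j, .inl k, .inl l => A i j k l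
  | .inl i, .inr j, .inr k, .inl l => m i l j k
  | .inr i, .inl j, .inl k, .inr l => m j k i l
  | .inl i, .inr j, .inl k, .inr l => -m i k j l
  | .inr i, .inl j, .inr k, .inl l => -m j l i k
  | .inr i, .inr j, .inr k, .inr l => D i j k l
  | _, _, _, _ => 0

namespace IsWarpedAt

variable {g₁ : E → Matrix ι ι ℝ} {φ : E → ℝ} {g₂ : E' → Matrix κ κ ℝ} {z : E × E'}
  (h : IsWarpedAt g₁ φ g₂ z) (b : Module.Basis ι ℝ E) (b' : Module.Basis κ ℝ E')

include h

theorem eventually : ∀ᶠ w in 𝓝 z, IsWarpedAt g₁ φ g₂ w := by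
  filter_upwards [continuousAt_fst.eventually h.base.eventually,
    continuousAt_snd.eventually h.fiber.eventually,
    continuousAt_fst.eventually (h.contDiffAt.eventually (by simp)),
    continuousAt_fst.eventually (h.contDiffAt.continuousAt.eventually_ne h.ne_zero)]
    with w h₁ h₂ h₃ h₄
  exact ⟨h₁, h₂, h₃, h₄⟩

theorem differentiableAt_warping : DifferentiableAt ℝ φ z.1 :=
  h.contDiffAt.differentiableAt two_ne_zero

theorem isMetricAt_warpedMatrix : IsMetricAt (warpedMatrix g₁ φ g₂) z where
  symm := by
    filter_upwards [continuousAt_fst.eventually h.base.symm,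
      continuousAt_snd.eventually h.fiber.symm] with w h₁ h₂
    exact h₁.fromBlocks Matrix.transpose_zero (h₂.smul _)
  isUnit_det := by
    rw [warpedMatrix, Matrix.det_fromBlocks_zero₂₁, Matrix.det_smul]
    exact h.base.isUnit_det.mul ((h.ne_zero.isUnit.pow _).mul h.fiber.isUnit_det)
  contDiffAt i j := by
    rcases i with i | i <;> rcases j with j | j
    · exact (h.base.contDiffAt i j).comp z contDiffAt_fst
    · exact contDiffAt_const
    · exact contDiffAt_const
    · exact (h.contDiffAt.comp z contDiffAt_fst).mul
        ((h.fiber.contDiffAt i j).comp z contDiffAt_snd)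

theorem sumElim_dotProduct_inv_mulVec (u u' : ι → ℝ) (v v' : κ → ℝ) :
    Sum.elim u v ⬝ᵥ ((warpedMatrix g₁ φ g₂ z)⁻¹ *ᵥ Sum.elim u' v')
      = u ⬝ᵥ ((g₁ z.1)⁻¹ *ᵥ u') + (φ z.1)⁻¹ * (v ⬝ᵥ ((g₂ z.2)⁻¹ *ᵥ v')) := by
  rw [warpedMatrix, inv_fromBlocks_diag_smul h.base.isUnit_det h.fiber.isUnit_det h.ne_zero]
  simp [Matrix.fromBlocks_mulVec, Matrix.smul_mulVec]

theorem pd_warpedMatrix_inl_inl (c : ι ⊕ κ) (i j : ι) :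
    pd (b.prod b') c (fun w => warpedMatrix g₁ φ g₂ w (.inl i) (.inl j)) z
      = Sum.elim (fun c => pd b c (fun w => g₁ w i j) z.1) 0 c :=
  pd_prod_fst b b' (h.base.differentiableAt i j) c

theorem pd_warpedMatrix_inr_inr (c : ι ⊕ κ) (i j : κ) :
    pd (b.prod b') c (fun w => warpedMatrix g₁ φ g₂ w (.inr i) (.inr j)) z
      = Sum.elim (fun c => pd b c φ z.1 * g₂ z.2 i j)
        (fun c => φ z.1 * pd b' c (fun w => g₂ w i j) z.2) c :=
  pd_prod_mul b b' h.differentiableAt_warping (h.fiber.differentiableAt i j) c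

theorem christoffelFirst_inl_inl (i j : ι) :
    christoffelFirst (b.prod b') (warpedMatrix g₁ φ g₂) (.inl i) (.inl j) z
      = Sum.elim (christoffelFirst b g₁ i j z.1) 0 := by
  ext (l | l) <;>
    simp [christoffelFirst, h.pd_warpedMatrix_inl_inl, pd_warpedMatrix_inl_inr]

theorem christoffelFirst_inl_inr (i : ι) (j : κ) :
    christoffelFirst (b.prod b') (warpedMatrix g₁ φ g₂) (.inl i) (.inr j) z
      = Sum.elim (0 : ι → ℝ) ((pd b i φ z.1 / 2) • g₂ z.2 j) := by
  ext (l | l)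
  · simp [christoffelFirst, h.pd_warpedMatrix_inl_inl, pd_warpedMatrix_inl_inr,
      pd_warpedMatrix_inr_inl]
  · simp only [christoffelFirst, h.pd_warpedMatrix_inr_inr, pd_warpedMatrix_inl_inr, Sum.elim_inl,
      Sum.elim_inr, Pi.smul_apply, smul_eq_mul]
    ring

theorem christoffelFirst_inr_inl (i : κ) (j : ι) :
    christoffelFirst (b.prod b') (warpedMatrix g₁ φ g₂) (.inr i) (.inl j) z
      = Sum.elim (0 : ι → ℝ) ((pd b j φ z.1 / 2) • g₂ z.2 i) := by
  rw [h.isMetricAt_warpedMatrix.christoffelFirst_symm, h.christoffelFirst_inl_inr]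

theorem christoffelFirst_inr_inr (i j : κ) :
    christoffelFirst (b.prod b') (warpedMatrix g₁ φ g₂) (.inr i) (.inr j) z
      = Sum.elim (-(g₂ z.2 i j / 2) • fun l => pd b l φ z.1)
        (φ z.1 • christoffelFirst b' g₂ i j z.2) := by
  ext (l | l) <;>
    simp only [christoffelFirst, h.pd_warpedMatrix_inr_inr, pd_warpedMatrix_inr_inl, Sum.elim_inl,
      Sum.elim_inr, Pi.smul_apply, smul_eq_mul] <;>
    ring

theorem pd_christoffelFirst_inl_inl_inl (c : ι ⊕ κ) (i j l : ι) :
    pd (b.prod b') c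
        (fun w =>
          christoffelFirst (b.prod b') (warpedMatrix g₁ φ g₂) (.inl i) (.inl j) w (.inl l))
        z
      = Sum.elim (fun c => pd b c (fun w => christoffelFirst b g₁ i j w l) z.1) 0 c := by
  rw [pd_congr _ (h.eventually.mono fun w hw =>
    congrFun (hw.christoffelFirst_inl_inl b b' i j) (.inl l))]
  exact pd_prod_fst b b' (h.base.differentiableAt_christoffelFirst b i j l) c

theorem pd_christoffelFirst_inl_inr_inl (c : ι ⊕ κ) (i : ι) (j : κ) (l : ι) :
    pd (b.prod b') c
        (fun w =>
          christoffelFirst (b.prod b') (warpedMatrix g₁ φ g₂) (.inl i) (.inr j) w (.inl l))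
        z
      = 0 := by
  rw [pd_congr _ (h.eventually.mono fun w hw =>
    congrFun (hw.christoffelFirst_inl_inr b b' i j) (.inl l))]
  exact pd_zero _ c z

theorem pd_christoffelFirst_inr_inl_inl (c : ι ⊕ κ) (i : κ) (j l : ι) :
    pd (b.prod b') c
        (fun w =>
          christoffelFirst (b.prod b') (warpedMatrix g₁ φ g₂) (.inr i) (.inl j) w (.inl l))
        z
      = 0 := by
  rw [pd_congr _ (h.eventually.mono fun w hw =>
    congrFun (hw.christoffelFirst_inr_inl b b' i j) (.inl l))]
  exact pd_zero _ c z

theorem pd_christoffelFirst_inr_inr_inl (c : ι ⊕ κ) (i j : κ) (l : ι) :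
    pd (b.prod b') c
        (fun w =>
          christoffelFirst (b.prod b') (warpedMatrix g₁ φ g₂) (.inr i) (.inr j) w (.inl l))
        z
      = -(1 / 2) * Sum.elim (fun c => pd b c (pd b l φ) z.1 * g₂ z.2 i j)
        (fun c => pd b l φ z.1 * pd b' c (fun w => g₂ w i j) z.2) c := by
  have hφ : DifferentiableAt ℝ (pd b l φ) z.1 :=
    (contDiffAt_pd b h.contDiffAt l).differentiableAt one_ne_zero
  have hg := h.fiber.differentiableAt i j
  have e : (fun w => christoffelFirst (b.prod b') (warpedMatrix g₁ φ g₂) (.inr i) (.inr j) w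
      (.inl l)) =ᶠ[𝓝 z] fun w => -(1 / 2) * (pd b l φ w.1 * g₂ w.2 i j) :=
    h.eventually.mono fun w hw => by
      simp only [hw.christoffelFirst_inr_inr, Sum.elim_inl, Pi.smul_apply, smul_eq_mul]
      ring
  have hd : DifferentiableAt ℝ (fun w : E × E' => pd b l φ w.1 * g₂ w.2 i j) z :=
    (hφ.comp z differentiableAt_fst).mul (hg.comp z differentiableAt_snd)
  rw [pd_congr _ e, pd_const_mul _ hd, pd_prod_mul b b' hφ hg]

theorem pd_christoffelFirst_inr_inr_inr (c i j l : κ) :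
    pd (b.prod b') (.inr c)
        (fun w =>
          christoffelFirst (b.prod b') (warpedMatrix g₁ φ g₂) (.inr i) (.inr j) w (.inr l))
        z
      = φ z.1 * pd b' c (fun w => christoffelFirst b' g₂ i j w l) z.2 := by
  rw [pd_congr _ (h.eventually.mono fun w hw =>
    congrFun (hw.christoffelFirst_inr_inr b b' i j) (.inr l))]
  exact pd_prod_mul b b' h.differentiableAt_warping
    (h.fiber.differentiableAt_christoffelFirst b' i j l) (.inr c)

theorem riemann_inl_inl_inl_inl (i j k l : ι) :
    riemann (b.prod b') (warpedMatrix g₁ φ g₂) z (.inl i) (.inl j) (.inl k) (.inl l)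
      = riemann b g₁ z.1 i j k l := by
  rw [h.isMetricAt_warpedMatrix.riemann_eq, h.base.riemann_eq]
  simp only [h.pd_christoffelFirst_inl_inl_inl, h.christoffelFirst_inl_inl,
    h.sumElim_dotProduct_inv_mulVec, zero_dotProduct, mul_zero, add_zero, Sum.elim_inl]

theorem riemann_inl_inl_inl_inr (i j k : ι) (l : κ) :
    riemann (b.prod b') (warpedMatrix g₁ φ g₂) z (.inl i) (.inl j) (.inl k) (.inr l) = 0 := by
  rw [h.isMetricAt_warpedMatrix.riemann_eq]
  simp [h.pd_christoffelFirst_inl_inl_inl, h.pd_christoffelFirst_inl_inr_inl,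
    h.christoffelFirst_inl_inl, h.christoffelFirst_inl_inr, h.christoffelFirst_inr_inl,
    h.sumElim_dotProduct_inv_mulVec]

theorem riemann_inl_inl_inr_inr (i j : ι) (k l : κ) :
    riemann (b.prod b') (warpedMatrix g₁ φ g₂) z (.inl i) (.inl j) (.inr k) (.inr l) = 0 := by
  rw [h.isMetricAt_warpedMatrix.riemann_eq]
  simp only [h.pd_christoffelFirst_inl_inr_inl, h.christoffelFirst_inl_inr,
    h.christoffelFirst_inr_inl, h.sumElim_dotProduct_inv_mulVec, zero_dotProduct, smul_dotProduct,
    Matrix.mulVec_smul, dotProduct_smul, dotProduct_inv_mulVec h.fiber.isUnit_det,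
    h.fiber.symm.self_of_nhds.apply k l]
  ring

theorem riemann_inl_inr_inr_inl (i l : ι) (j k : κ) :
    riemann (b.prod b') (warpedMatrix g₁ φ g₂) z (.inl i) (.inr j) (.inr k) (.inl l)
      = warpingTensor b g₁ φ z.1 i l * (φ z.1 • g₂ z.2) j k := by
  have hφ := h.ne_zero
  rw [h.isMetricAt_warpedMatrix.riemann_eq]
  simp only [h.pd_christoffelFirst_inr_inr_inl, h.pd_christoffelFirst_inr_inl_inl,
    h.christoffelFirst_inl_inl, h.christoffelFirst_inr_inl, h.christoffelFirst_inr_inr,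
    h.sumElim_dotProduct_inv_mulVec, zero_dotProduct, smul_dotProduct, Matrix.mulVec_smul,
    dotProduct_smul, smul_eq_mul, dotProduct_inv_mulVec h.fiber.isUnit_det, Sum.elim_inl,
    warpingTensor, hessian_eq, Matrix.smul_apply,
    h.base.christoffelFirst_symm b l i]
  rw [dotProduct_mulVec_comm (inv_isSymm h.base.symm.self_of_nhds),
    dotProduct_comm ((g₁ z.1)⁻¹ *ᵥ _)]
  field_simp
  ring

theorem riemann_inl_inr_inr_inr (i : ι) (j k l : κ) :
    riemann (b.prod b') (warpedMatrix g₁ φ g₂) z (.inl i) (.inr j) (.inr k) (.inr l) = 0 := by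
  have hφ := h.ne_zero
  rw [h.isMetricAt_warpedMatrix.riemann_eq]
  simp only [h.pd_christoffelFirst_inr_inr_inl, h.christoffelFirst_inr_inl,
    h.christoffelFirst_inr_inr, h.sumElim_dotProduct_inv_mulVec, zero_dotProduct, smul_dotProduct,
    Matrix.mulVec_smul, dotProduct_smul, smul_eq_mul, dotProduct_inv_mulVec h.fiber.isUnit_det,
    Sum.elim_inr, h.fiber.pd_eq_christoffelFirst_add,
    h.fiber.christoffelFirst_symm b' l j, h.fiber.christoffelFirst_symm b' k j,
    h.fiber.christoffelFirst_symm b' l k]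
  field_simp
  ring

theorem riemann_inr_inr_inr_inr (i j k l : κ) :
    riemann (b.prod b') (warpedMatrix g₁ φ g₂) z (.inr i) (.inr j) (.inr k) (.inr l)
      = φ z.1 * riemann b' g₂ z.2 i j k l - φ z.1 ^ 2 / 2 * warpingScalar b g₁ φ z.1
        * kulkarniNomizu (g₂ z.2) (g₂ z.2) i j k l := by
  have hφ := h.ne_zero
  have hs := h.fiber.symm.self_of_nhds
  rw [h.isMetricAt_warpedMatrix.riemann_eq, h.fiber.riemann_eq]
  simp only [h.pd_christoffelFirst_inr_inr_inr, h.christoffelFirst_inr_inr,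
    h.sumElim_dotProduct_inv_mulVec, smul_dotProduct, Matrix.mulVec_smul, dotProduct_smul,
    smul_eq_mul, warpingScalar, kulkarniNomizu, hs.apply i k, hs.apply i l]
  field_simp
  ring

theorem riemann_eq_blockCurvature :
    riemann (b.prod b') (warpedMatrix g₁ φ g₂) z
      = blockCurvature (riemann b g₁ z.1)
        (fun a c i j => warpingTensor b g₁ φ z.1 a c * (φ z.1 • g₂ z.2) i j)
        fun i j k l => φ z.1 * riemann b' g₂ z.2 i j k l
          - φ z.1 ^ 2 / 2 * warpingScalar b g₁ φ z.1
            * kulkarniNomizu (g₂ z.2) (g₂ z.2) i j k l := by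
  have hG := h.isMetricAt_warpedMatrix
  funext i j k l
  rcases i with i | i <;> rcases j with j | j <;> rcases k with k | k <;> rcases l with l | l <;>
    simp only [blockCurvature]
  case inl.inl.inl.inl => exact h.riemann_inl_inl_inl_inl b b' i j k l
  case inl.inl.inl.inr => exact h.riemann_inl_inl_inl_inr b b' i j k l
  case inl.inl.inr.inl => rw [riemann_swap_right, h.riemann_inl_inl_inl_inr, neg_zero]
  case inl.inl.inr.inr => exact h.riemann_inl_inl_inr_inr b b' i j k l
  case inl.inr.inl.inl => rw [hG.riemann_pair_symm, h.riemann_inl_inl_inl_inr]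
  case inl.inr.inl.inr => rw [riemann_swap_right, h.riemann_inl_inr_inr_inl]
  case inl.inr.inr.inl => exact h.riemann_inl_inr_inr_inl b b' i l j k
  case inl.inr.inr.inr => exact h.riemann_inl_inr_inr_inr b b' i j k l
  case inr.inl.inl.inl =>
    rw [hG.riemann_pair_symm, riemann_swap_right, h.riemann_inl_inl_inl_inr, neg_zero]
  case inr.inl.inl.inr => rw [hG.riemann_swap_swap, h.riemann_inl_inr_inr_inl]
  case inr.inl.inr.inl => rw [hG.riemann_swap_left, h.riemann_inl_inr_inr_inl]
  case inr.inl.inr.inr => rw [hG.riemann_swap_left, h.riemann_inl_inr_inr_inr, neg_zero]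
  case inr.inr.inl.inl => rw [hG.riemann_pair_symm, h.riemann_inl_inl_inr_inr]
  case inr.inr.inl.inr => rw [hG.riemann_pair_symm, h.riemann_inl_inr_inr_inr]
  case inr.inr.inr.inl =>
    rw [riemann_swap_right, hG.riemann_pair_symm, h.riemann_inl_inr_inr_inr, neg_zero]
  case inr.inr.inr.inr => exact h.riemann_inr_inr_inr_inr b b' i j k l

end IsWarpedAt

end WarpedCoordinates

/-! ### Contractions and quadratic forms -/

section Contractions

variable {ι κ : Type*} [Fintype ι] [Fintype κ]

theorem contract_eq_mul (A X Y : Matrix ι ι ℝ) : contract A X Y = X * A * Yᵀ := by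
  ext i j
  simp only [contract, Matrix.mul_apply, Matrix.transpose_apply, Finset.sum_mul]
  rw [Finset.sum_comm]
  exact Finset.sum_congr rfl fun l _ => Finset.sum_congr rfl fun m _ => by ring

theorem contract_add_smul_self (A X Y : Matrix ι ι ℝ) (c : ℝ) :
    contract A (X + c • Y) (X + c • Y)
      = contract A X X + c • (contract A X Y + contract A Y X) + c ^ 2 • contract A Y Y := by
  simp only [contract_eq_mul, Matrix.add_mul, Matrix.mul_add, Matrix.transpose_add,
    Matrix.transpose_smul, Matrix.smul_mul, Matrix.mul_smul, smul_add, smul_smul, pow_two]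
  abel

theorem contract_smul (A X Y : Matrix ι ι ℝ) (c : ℝ) :
    contract (c • A) X Y = c • contract A X Y := by
  simp only [contract_eq_mul, Matrix.mul_smul, Matrix.smul_mul]

theorem contract_fromBlocks (A X Y : Matrix ι ι ℝ) (D X' Y' : Matrix κ κ ℝ) :
    contract (Matrix.fromBlocks A 0 0 D) (Matrix.fromBlocks X 0 0 X') (Matrix.fromBlocks Y 0 0 Y')
      = Matrix.fromBlocks (contract A X Y) 0 0 (contract D X' Y') := by
  simp [contract_eq_mul, Matrix.fromBlocks_multiply, Matrix.fromBlocks_transpose]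

theorem metricTrace_smul_smul (A X : Matrix ι ι ℝ) (c d : ℝ) :
    metricTrace (c • A) (d • X) = c * d * metricTrace A X := by
  simp only [metricTrace, Matrix.smul_apply, smul_eq_mul, Finset.mul_sum]
  exact Finset.sum_congr rfl fun l _ => Finset.sum_congr rfl fun m _ => by ring

theorem ricciContraction_smul (A : Matrix ι ι ℝ) (R : ι → ι → ι → ι → ℝ) (c : ℝ) :
    ricciContraction (c • A) R = c • ricciContraction A R := by
  ext i j
  simp only [ricciContraction, Matrix.smul_apply, smul_eq_mul, Finset.mul_sum, mul_assoc]

theorem ricciContraction_sub (A : Matrix ι ι ℝ) (R R' : ι → ι → ι → ι → ℝ) (c d : ℝ) :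
    ricciContraction A (fun i j k l => c * R i j k l - d * R' i j k l)
      = c • ricciContraction A R - d • ricciContraction A R' := by
  ext i j
  simp only [ricciContraction, Matrix.sub_apply, Matrix.smul_apply, smul_eq_mul, Finset.mul_sum,
    ← Finset.sum_sub_distrib]
  exact Finset.sum_congr rfl fun l _ => Finset.sum_congr rfl fun m _ => by ring

theorem ricciContraction_blockCurvature (A : Matrix ι ι ℝ) (D : Matrix κ κ ℝ)
    (R : ι → ι → ι → ι → ℝ) (T : Matrix ι ι ℝ) (k : Matrix κ κ ℝ) (R' : κ → κ → κ → κ → ℝ) :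
    ricciContraction (Matrix.fromBlocks A 0 0 D)
        (blockCurvature R (fun a b i j => T a b * k i j) R')
      = Matrix.fromBlocks (ricciContraction A R + metricTrace D k • T) 0 0
        (metricTrace A T • k + ricciContraction D R') := by
  ext (i | i) (j | j) <;>
    simp only [ricciContraction, Fintype.sum_sum_type, blockCurvature, metricTrace,
      Matrix.fromBlocks_apply₁₁, Matrix.fromBlocks_apply₁₂, Matrix.fromBlocks_apply₂₁,
      Matrix.fromBlocks_apply₂₂, Matrix.add_apply, Matrix.smul_apply, Matrix.zero_apply,
      smul_eq_mul, Finset.sum_mul, zero_mul, mul_zero, Finset.sum_const_zero, add_zero, zero_add,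
      mul_assoc]
  congr 1
  exact Finset.sum_congr rfl fun l _ => Finset.sum_congr rfl fun m _ => by ring

theorem ricciContraction_kulkarniNomizu (A : Matrix ι ι ℝ) {X Y : Matrix ι ι ℝ} (hX : X.IsSymm)
    (hY : Y.IsSymm) :
    ricciContraction A (kulkarniNomizu X Y)
      = metricTrace A X • Y + metricTrace A Y • X - (contract A X Y)ᵀ - (contract A Y X)ᵀ := by
  ext j k
  simp only [ricciContraction, kulkarniNomizu, metricTrace, contract, Matrix.sub_apply,
    Matrix.add_apply, Matrix.smul_apply, Matrix.transpose_apply, smul_eq_mul, Finset.sum_mul,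
    ← Finset.sum_add_distrib, ← Finset.sum_sub_distrib, hX.apply k, hY.apply k]
  exact Finset.sum_congr rfl fun l _ => Finset.sum_congr rfl fun m _ => by ring

variable [DecidableEq ι] {A : Matrix ι ι ℝ} (hA : IsUnit A.det)

include hA

theorem contract_inv_left (Y : Matrix ι ι ℝ) : contract A⁻¹ A Y = Yᵀ := by
  rw [contract_eq_mul, Matrix.mul_nonsing_inv _ hA, one_mul]

variable (hs : A.IsSymm)

include hs

theorem contract_inv_right (Y : Matrix ι ι ℝ) : contract A⁻¹ Y A = Y := by
  rw [contract_eq_mul, hs.eq, mul_assoc, Matrix.nonsing_inv_mul _ hA, mul_one]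

theorem metricTrace_inv_self : metricTrace A⁻¹ A = Fintype.card ι := by
  have eq_trace : metricTrace A⁻¹ A = (A⁻¹ * Aᵀ).trace := by
    simp [metricTrace, Matrix.trace, Matrix.mul_apply]
  rw [eq_trace, hs.eq, Matrix.nonsing_inv_mul _ hA, Matrix.trace_one]

theorem ricciContraction_kulkarniNomizu_self :
    ricciContraction A⁻¹ (kulkarniNomizu A A) = (2 * ((Fintype.card ι : ℝ) - 1)) • A := by
  rw [ricciContraction_kulkarniNomizu _ hs hs, metricTrace_inv_self hA hs,
    contract_inv_right hA hs, hs.eq]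
  module

end Contractions

section QuadraticForms

variable {ι κ ρ τ : Type*} [Fintype ρ] [Fintype τ]

/-- The tensor `∑ A_{rs} V_r ⊗ W_s`. -/
def tensorForm (A : Matrix ρ τ ℝ) (V : ρ → Matrix ι ι ℝ) (W : τ → Matrix κ κ ℝ) (a b : ι)
    (i j : κ) : ℝ :=
  ∑ r, ∑ s, A r s * (V r a b * W s i j)

/-- The tensor `∑ A_{rs} V_r ∧ V_s`, where `∧` is the Kulkarni-Nomizu product. -/
def kulkarniNomizuForm (A : Matrix ρ ρ ℝ) (V : ρ → Matrix ι ι ℝ) (i j k l : ι) : ℝ :=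
  ∑ r, ∑ s, A r s * kulkarniNomizu (V r) (V s) i j k l

/-- The family of the linear combinations `∑ M_{rs} V_s`. -/
def recombine (M : Matrix ρ τ ℝ) (V : τ → Matrix ι ι ℝ) (r : ρ) : Matrix ι ι ℝ :=
  ∑ s, M r s • V s

theorem tensorForm_eq_dotProduct (A : Matrix ρ τ ℝ) (V : ρ → Matrix ι ι ℝ)
    (W : τ → Matrix κ κ ℝ) (a b : ι) (i j : κ) :
    tensorForm A V W a b i j = (V · a b) ⬝ᵥ (A *ᵥ (W · i j)) := by
  simp only [tensorForm, dotProduct, Matrix.mulVec, Finset.mul_sum]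
  exact Finset.sum_congr rfl fun r _ => Finset.sum_congr rfl fun s _ => by ring

theorem tensorForm_transpose (A : Matrix ρ τ ℝ) (V : ρ → Matrix ι ι ℝ) (W : τ → Matrix κ κ ℝ)
    (a b : ι) (i j : κ) : tensorForm Aᵀ W V i j a b = tensorForm A V W a b i j := by
  rw [tensorForm_eq_dotProduct, tensorForm_eq_dotProduct, Matrix.mulVec_transpose,
    dotProduct_comm, Matrix.dotProduct_mulVec]

omit [Fintype ρ] in
theorem recombine_apply (M : Matrix ρ τ ℝ) (V : τ → Matrix ι ι ℝ) (a b : ι) :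
    (recombine M V · a b) = M *ᵥ (V · a b) := by
  funext r
  simp [recombine, Matrix.mulVec, dotProduct, Matrix.sum_apply]

theorem tensorForm_recombine {ρ' τ' : Type*} [Fintype ρ'] [Fintype τ'] (A : Matrix ρ τ ℝ)
    (M : Matrix ρ ρ' ℝ) (N : Matrix τ τ' ℝ) (V : ρ' → Matrix ι ι ℝ) (W : τ' → Matrix κ κ ℝ) :
    tensorForm A (recombine M V) (recombine N W) = tensorForm (Mᵀ * A * N) V W := by
  funext a b i j
  simp only [tensorForm_eq_dotProduct, recombine_apply, ← Matrix.mulVec_mulVec]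
  rw [Matrix.dotProduct_mulVec _ Mᵀ, Matrix.vecMul_transpose]

theorem kulkarniNomizuForm_eq_tensorForm (A : Matrix ρ ρ ℝ) (V : ρ → Matrix ι ι ℝ)
    (i j k l : ι) :
    kulkarniNomizuForm A V i j k l
      = tensorForm A V V i l j k + tensorForm A V V j k i l
        - tensorForm A V V i k j l - tensorForm A V V j l i k := by
  simp only [kulkarniNomizuForm, kulkarniNomizu, tensorForm, mul_add, mul_sub,
    Finset.sum_add_distrib, Finset.sum_sub_distrib]

theorem kulkarniNomizuForm_recombine (A : Matrix ρ ρ ℝ) (M : Matrix ρ τ ℝ)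
    (V : τ → Matrix ι ι ℝ) :
    kulkarniNomizuForm A (recombine M V) = kulkarniNomizuForm (Mᵀ * A * M) V := by
  funext i j k l
  simp only [kulkarniNomizuForm_eq_tensorForm, tensorForm_recombine]

theorem kulkarniNomizuForm_fromBlocks {A : Matrix ρ ρ ℝ} (hA : A.IsSymm)
    (V : ρ → Matrix ι ι ℝ) (W : ρ → Matrix κ κ ℝ) :
    kulkarniNomizuForm A (fun r => Matrix.fromBlocks (V r) 0 0 (W r))
      = blockCurvature (kulkarniNomizuForm A V) ((2 : ℝ) • tensorForm A V W)
        (kulkarniNomizuForm A W) := by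
  have comm (a b : ι) (i j : κ) : tensorForm A W V i j a b = tensorForm A V W a b i j := by
    rw [← tensorForm_transpose, hA.eq]
  funext i j k l
  have tensorForm_blocks (i j k l : ι ⊕ κ) :
      tensorForm A (fun r => Matrix.fromBlocks (V r) 0 0 (W r))
          (fun r => Matrix.fromBlocks (V r) 0 0 (W r)) i j k l
        = match i, j, k, l with
          | .inl a, .inl b, .inl c, .inl d => tensorForm A V V a b c d
          | .inl a, .inl b, .inr i, .inr j => tensorForm A V W a b i j
          | .inr i, .inr j, .inl a, .inl b => tensorForm A V W a b i j
          | .inr i, .inr j, .inr k, .inr l => tensorForm A W W i j k l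
          | _, _, _, _ => 0 := by
    rcases i with i | i <;> rcases j with j | j <;> rcases k with k | k <;> rcases l with l | l <;>
      first | (simp [tensorForm]; done) | simpa [tensorForm] using comm k l i j
  simp only [kulkarniNomizuForm_eq_tensorForm, tensorForm_blocks]
  rcases i with i | i <;> rcases j with j | j <;> rcases k with k | k <;> rcases l with l | l <;>
    simp [blockCurvature, kulkarniNomizuForm_eq_tensorForm, two_mul, sub_eq_add_neg]

theorem tensorForm_sub_smul (A A' : Matrix ρ τ ℝ) (c : ℝ) (V : ρ → Matrix ι ι ℝ)
    (W : τ → Matrix κ κ ℝ) :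
    tensorForm (A - c • A') V W = tensorForm A V W - c • tensorForm A' V W := by
  funext a b i j
  simp only [tensorForm_eq_dotProduct, Pi.sub_apply, Pi.smul_apply, Matrix.sub_mulVec,
    Matrix.smul_mulVec, dotProduct_sub, dotProduct_smul]

theorem kulkarniNomizuForm_add (A A' : Matrix ρ ρ ℝ) (V : ρ → Matrix ι ι ℝ) :
    kulkarniNomizuForm (A + A') V = kulkarniNomizuForm A V + kulkarniNomizuForm A' V := by
  funext i j k l
  simp only [kulkarniNomizuForm, Matrix.add_apply, add_mul, Finset.sum_add_distrib, Pi.add_apply]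

theorem tensorForm_single [DecidableEq ρ] [DecidableEq τ] (r : ρ) (s : τ) (c : ℝ)
    (V : ρ → Matrix ι ι ℝ) (W : τ → Matrix κ κ ℝ) (a b : ι) (i j : κ) :
    tensorForm (Matrix.single r s c) V W a b i j = c * (V r a b * W s i j) := by
  rw [tensorForm_eq_dotProduct, Matrix.single_mulVec]
  exact (dotProduct_single _ _ _).trans (by ring)

theorem kulkarniNomizuForm_single [DecidableEq ρ] (r s : ρ) (c : ℝ) (V : ρ → Matrix ι ι ℝ)
    (i j k l : ι) :
    kulkarniNomizuForm (Matrix.single r s c) V i j k l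
      = c * kulkarniNomizu (V r) (V s) i j k l := by
  simp only [kulkarniNomizuForm_eq_tensorForm, tensorForm_single, kulkarniNomizu]
  ring

theorem blockCurvature_inj {R S : ι → ι → ι → ι → ℝ} {m n : ι → ι → κ → κ → ℝ}
    {R' S' : κ → κ → κ → κ → ℝ} :
    blockCurvature R m R' = blockCurvature S n S' ↔ R = S ∧ m = n ∧ R' = S' := by
  refine ⟨fun h => ⟨?_, ?_, ?_⟩, by rintro ⟨rfl, rfl, rfl⟩; rfl⟩
  · funext a b c d
    exact congrFun (congrFun (congrFun (congrFun h (.inl a)) (.inl b)) (.inl c)) (.inl d)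
  · funext a b i j
    exact congrFun (congrFun (congrFun (congrFun h (.inl a)) (.inr i)) (.inr j)) (.inl b)
  · funext i j k l
    exact congrFun (congrFun (congrFun (congrFun h (.inr i)) (.inr j)) (.inr k)) (.inr l)

end QuadraticForms

section Tables

variable (q : ℕ) (f P Q L₁ L₂ L₃ L₄ L₅ L₆ : ℝ)

/-- The coefficients of the generalized Roter type condition with respect to `g, S, S²`. -/
noncomputable def roterTable : Matrix (Fin 3) (Fin 3) ℝ :=
  !![L₁, L₂ / 2, L₄ / 2; L₂ / 2, L₃, L₅ / 2; L₄ / 2, L₅ / 2, L₆]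

/-- The base components of `g, S, S²` of a warped product in terms of
`ḡ, S̄, S̄², T, T², S̄·T`. -/
def baseChange : Matrix (Fin 3) (Fin 6) ℝ :=
  !![1, 0, 0, 0, 0, 0; 0, 1, 0, q, 0, 0; 0, 0, 1, 0, q ^ 2, q]

/-- The fiber components of `g, S, S²` of a warped product in terms of `g̃, S̃, S̃²`. -/
noncomputable def fiberChange : Matrix (Fin 3) (Fin 3) ℝ :=
  !![f, 0, 0; Q, 1, 0; Q ^ 2 / f, 2 * Q / f, 1 / f]

theorem roterTable_isSymm : (roterTable L₁ L₂ L₃ L₄ L₅ L₆).IsSymm := by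
  ext i j
  fin_cases i <;> fin_cases j <;> rfl

theorem baseTable_eq :
    baseTable q L₁ L₂ L₃ L₄ L₅ L₆
      = (baseChange q)ᵀ * roterTable L₁ L₂ L₃ L₄ L₅ L₆ * baseChange q := by
  ext i j
  fin_cases i <;> fin_cases j <;>
    simp only [baseTable, baseChange, roterTable, Matrix.mul_apply, Matrix.transpose_apply,
      Fin.sum_univ_three, Matrix.of_apply, Matrix.cons_val', Matrix.cons_val_fin_one,
      Matrix.cons_val, Fin.zero_eta, Fin.mk_one, Fin.reduceFinMk] <;>
    ring

variable {f} (hf : f ≠ 0)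

include hf

theorem mixedTable_eq :
    mixedTable q f Q L₁ L₂ L₃ L₄ L₅ L₆
      = Matrix.single 3 0 f
        - (2 : ℝ) • ((baseChange q)ᵀ * roterTable L₁ L₂ L₃ L₄ L₅ L₆ * fiberChange f Q) := by
  ext i j
  fin_cases i <;> fin_cases j <;>
    simp only [mixedTable, baseChange, fiberChange, roterTable, Matrix.sub_apply,
      Matrix.smul_apply, Matrix.single_apply, Matrix.mul_apply, Matrix.transpose_apply,
      Fin.sum_univ_three, Matrix.of_apply, Matrix.cons_val', Matrix.cons_val_fin_one,
      Matrix.cons_val, Fin.zero_eta, Fin.mk_one, Fin.reduceFinMk, Fin.reduceEq, and_true,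
      and_false, if_true, if_false, smul_eq_mul] <;>
    field_simp <;> ring

theorem fiberTable_eq :
    fiberTable f P Q L₁ L₂ L₃ L₄ L₅ L₆
      = (fiberChange f Q)ᵀ * roterTable L₁ L₂ L₃ L₄ L₅ L₆ * fiberChange f Q
        + Matrix.single 0 0 (f ^ 2 / 2 * P) := by
  ext i j
  fin_cases i <;> fin_cases j <;>
    simp only [fiberTable, fiberChange, roterTable, Matrix.add_apply, Matrix.single_apply,
      Matrix.mul_apply, Matrix.transpose_apply, Fin.sum_univ_three, Matrix.of_apply,
      Matrix.cons_val', Matrix.cons_val_fin_one, Matrix.cons_val, Fin.zero_eta, Fin.mk_one,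
      Fin.reduceFinMk, Fin.reduceEq, and_true, and_false, if_true, if_false] <;>
    field_simp <;> ring

end Tables

/-! ### The curvature and Ricci tensors of a warped product manifold -/

section Charts

variable {E : Type*} [NormedAddCommGroup E] [NormedSpace ℝ E]
  {H : Type*} [TopologicalSpace H] {I : ModelWithCorners ℝ E H}
  {B : Type*} [TopologicalSpace B] [ChartedSpace H B]

theorem localRep_self (f : B → ℝ) (x : B) : localRep I f x (extChartAt I x x) = f x := by
  rw [localRep, extChartAt_to_inv]

variable [IsManifold I ∞ B]

theorem contDiffAt_localRep [I.Boundaryless] {f : B → ℝ} (hf : ContMDiff I 𝓘(ℝ, ℝ) ∞ f) (x : B) :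
    ContDiffAt ℝ 2 (localRep I f x) (extChartAt I x x) := by
  have on_target : ContDiffOn ℝ ∞ (localRep I f x) (extChartAt I x).target :=
    contMDiffOn_iff_contDiffOn.1 (hf.comp_contMDiffOn (contMDiffOn_extChartAt_symm x))
  exact (on_target.contDiffAt (extChartAt_target_mem_nhds x)).of_le (WithTop.coe_le_coe.2 le_top)

namespace SemiRiemannianMetric

variable {ι : Type*} (g : SemiRiemannianMetric I B) (b : Module.Basis ι ℝ E) (x : B)

theorem metric_isSymm : (g.metric b x).IsSymm :=
  Matrix.IsSymm.ext fun _ _ => g.symm _ _ _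

theorem metric_apply (i j : ι) : g.metric b x i j = g.val x (b i) (b j) := by
  have of_eq (y : B) (h : y = x) :
      g.val y (tangentCoordChange I x y y (b i)) (tangentCoordChange I x y y (b j))
        = g.val x (b i) (b j) := by
    subst h
    rw [tangentCoordChange_self (mem_extChartAt_source y),
      tangentCoordChange_self (mem_extChartAt_source y)]
  exact of_eq _ (extChartAt_to_inv x)

variable [Fintype ι] [DecidableEq ι]

theorem isUnit_det_metric : IsUnit (g.metric b x).det := by
  let β : LinearMap.BilinForm ℝ E := g.val x
  have metric_eq : g.metric b x = LinearMap.BilinForm.toMatrix b β := by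
    ext i j
    exact (g.metric_apply b x i j).trans (LinearMap.BilinForm.toMatrix_apply b β i j).symm
  have nondegenerate : β.Nondegenerate :=
    ⟨g.nondegenerate x, fun u h => g.nondegenerate x u fun v => (g.symm x u v).trans (h v)⟩
  rw [metric_eq, isUnit_iff_ne_zero]
  exact (LinearMap.BilinForm.nondegenerate_iff_det_ne_zero b).1 nondegenerate

theorem isMetricAt_coord [I.Boundaryless] : IsMetricAt (g.coord b x) (extChartAt I x x) where
  symm := Eventually.of_forall fun _ => Matrix.IsSymm.ext fun _ _ => g.symm _ _ _
  isUnit_det := g.isUnit_det_metric b x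
  contDiffAt i j := ((g.smooth x (b i) (b j)).contDiffAt (extChartAt_target_mem_nhds x)).of_le
    (WithTop.coe_le_coe.2 le_top)

theorem ricci_isSymm [I.Boundaryless] : (g.ricci b x).IsSymm :=
  (g.isMetricAt_coord b x).ricciContraction_isSymm b

theorem tensorT_eq (f : B → ℝ) :
    g.tensorT b f x = warpingTensor b (g.coord b x) (localRep I f x) (extChartAt I x x) := by
  ext i j
  rw [tensorT, warpingTensor, localRep_self]
  rfl

theorem scalarP_eq (f : B → ℝ) :
    g.scalarP b f x = warpingScalar b (g.coord b x) (localRep I f x) (extChartAt I x x) := by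
  rw [scalarP, warpingScalar, localRep_self]
  simp only [dotProduct, Matrix.mulVec, Finset.mul_sum]
  exact Finset.sum_congr rfl fun a _ => Finset.sum_congr rfl fun c _ => by
    change _ * (g.inv b x a c * pd b a _ _ * pd b c _ _) = _ * (_ * (g.inv b x a c * _))
    ring

/-- The tensors `g, S, S²` at a point. -/
noncomputable def ricciFamily : Fin 3 → Matrix ι ι ℝ :=
  ![g.metric b x, g.ricci b x, g.ricciSq b x]

/-- The tensors `g, S, S², T, T², S·T` at a point of the base of a warped product. -/
noncomputable def warpingFamily (f : B → ℝ) : Fin 6 → Matrix ι ι ℝ :=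
  ![g.metric b x, g.ricci b x, g.ricciSq b x, g.tensorT b f x, g.tensorTSq b f x,
    g.tensorST b f x]

theorem isGeneralizedRoterTypeWith_iff (L₁ L₂ L₃ L₄ L₅ L₆ : B → ℝ) :
    g.IsGeneralizedRoterTypeWith b L₁ L₂ L₃ L₄ L₅ L₆ ↔
      ∀ x, g.curvature b x
        = kulkarniNomizuForm (roterTable (L₁ x) (L₂ x) (L₃ x) (L₄ x) (L₅ x) (L₆ x))
          (g.ricciFamily b x) := by
  simp only [IsGeneralizedRoterTypeWith, funext_iff]
  refine forall_congr' fun x => forall₄_congr fun i j k l => Eq.congr_right ?_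
  simp only [kulkarniNomizuForm, roterTable, ricciFamily, kulkarniNomizu, Fin.sum_univ_three,
    Matrix.of_apply, Matrix.cons_val', Matrix.cons_val_fin_one, Matrix.cons_val]
  ring

end SemiRiemannianMetric

end Charts

section WarpedProducts

variable {E : Type*} [NormedAddCommGroup E] [NormedSpace ℝ E]
  {H : Type*} [TopologicalSpace H] {I : ModelWithCorners ℝ E H}
  {B : Type*} [TopologicalSpace B] [ChartedSpace H B] [IsManifold I ∞ B]
  {E' : Type*} [NormedAddCommGroup E'] [NormedSpace ℝ E']
  {H' : Type*} [TopologicalSpace H'] {I' : ModelWithCorners ℝ E' H'}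
  {F : Type*} [TopologicalSpace F] [ChartedSpace H' F] [IsManifold I' ∞ F]
  {ι κ : Type*} (b : Module.Basis ι ℝ E) (b' : Module.Basis κ ℝ E')
  (gB : SemiRiemannianMetric I B) (gF : SemiRiemannianMetric I' F)
  {f : B → ℝ} (hf : ContMDiff I 𝓘(ℝ, ℝ) ∞ f) (hpos : ∀ x, 0 < f x) (x : B) (y : F)

open SemiRiemannianMetric

theorem coord_warpedMetric {z : E × E'} (hz : z ∈ (extChartAt (I.prod I') (x, y)).target) :
    (warpedMetric gB gF f hf hpos).coord (b.prod b') (x, y) z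
      = warpedMatrix (gB.coord b x) (localRep I f x) (gF.coord b' y) z := by
  have symm_eq : (extChartAt (I.prod I') (x, y)).symm z
      = ((extChartAt I x).symm z.1, (extChartAt I' y).symm z.2) := by
    rw [extChartAt_prod]; rfl
  have change_eq := tangentCoordChange_prod_apply (I := I) (I' := I') (x, y) _
    ((extChartAt (I.prod I') (x, y)).map_target hz)
  have zero_left (x) (v : E) : gB.val x (0 : E) v = 0 := LinearMap.map_zero₂ (gB.val x) v
  have zero_right (x) (v : E) : gB.val x v (0 : E) = 0 := map_zero (gB.val x v)
  have zero_left' (y) (v : E') : gF.val y (0 : E') v = 0 := LinearMap.map_zero₂ (gF.val y) v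
  have zero_right' (y) (v : E') : gF.val y v (0 : E') = 0 := map_zero (gF.val y v)
  ext i j
  change gB.val _ (tangentCoordChange (I.prod I') (x, y) _ _ _).1
      (tangentCoordChange (I.prod I') (x, y) _ _ _).1
    + f _ * gF.val _ (tangentCoordChange (I.prod I') (x, y) _ _ _).2
      (tangentCoordChange (I.prod I') (x, y) _ _ _).2 = _
  rw [change_eq, change_eq, symm_eq]
  rcases i with i | i <;> rcases j with j | j <;>
    simp only [Module.Basis.prod_apply_inl_fst, Module.Basis.prod_apply_inl_snd,
      Module.Basis.prod_apply_inr_fst, Module.Basis.prod_apply_inr_snd, map_zero, zero_left,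
      zero_right, zero_left', zero_right', mul_zero, add_zero, zero_add] <;>
    rfl

theorem metric_warpedMetric :
    (warpedMetric gB gF f hf hpos).metric (b.prod b') (x, y)
      = Matrix.fromBlocks (gB.metric b x) 0 0 (f x • gF.metric b' y) := by
  rw [metric, coord_warpedMetric b b' gB gF hf hpos x y (mem_extChartAt_target _),
    ← localRep_self (I := I) f x, extChartAt_prod]
  rfl

variable [Fintype ι] [DecidableEq ι] [Fintype κ] [DecidableEq κ]

theorem inv_warpedMetric :
    (warpedMetric gB gF f hf hpos).inv (b.prod b') (x, y)
      = Matrix.fromBlocks (gB.inv b x) 0 0 ((f x)⁻¹ • gF.inv b' y) := by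
  rw [inv, metric_warpedMetric]
  exact inv_fromBlocks_diag_smul (gB.isUnit_det_metric b x) (gF.isUnit_det_metric b' y)
    (hpos x).ne'

variable [I.Boundaryless] [I'.Boundaryless]

theorem curvature_warpedMetric :
    (warpedMetric gB gF f hf hpos).curvature (b.prod b') (x, y)
      = blockCurvature (gB.curvature b x)
        (fun a c i j => gB.tensorT b f x a c * (f x • gF.metric b' y) i j)
        fun i j k l => f x * gF.curvature b' y i j k l - f x ^ 2 / 2 * gB.scalarP b f x
          * kulkarniNomizu (gF.metric b' y) (gF.metric b' y) i j k l := by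
  have center : extChartAt (I.prod I') (x, y) (x, y) = (extChartAt I x x, extChartAt I' y y) := by
    rw [extChartAt_prod]; rfl
  have warped : IsWarpedAt (gB.coord b x) (localRep I f x) (gF.coord b' y)
      (extChartAt I x x, extChartAt I' y y) :=
    ⟨gB.isMetricAt_coord b x, gF.isMetricAt_coord b' y, contDiffAt_localRep hf x, (hpos _).ne'⟩
  have coord_eq : (warpedMetric gB gF f hf hpos).coord (b.prod b') (x, y)
      =ᶠ[𝓝 (extChartAt (I.prod I') (x, y) (x, y))]
        warpedMatrix (gB.coord b x) (localRep I f x) (gF.coord b' y) :=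
    eventually_of_mem (extChartAt_target_mem_nhds _) fun z hz =>
      coord_warpedMetric b b' gB gF hf hpos x y hz
  rw [curvature, riemann_congr _ coord_eq, center, warped.riemann_eq_blockCurvature b b',
    ← tensorT_eq, ← scalarP_eq]
  simp only [localRep_self]
  rfl

theorem ricci_warpedMetric :
    (warpedMetric gB gF f hf hpos).ricci (b.prod b') (x, y)
      = Matrix.fromBlocks (gB.ricci b x + (Fintype.card κ : ℝ) • gB.tensorT b f x) 0 0
        (gF.ricci b' y + gB.scalarQ b (Fintype.card κ) f x • gF.metric b' y) := by
  have f_ne := (hpos x).ne'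
  have trace_eq := metricTrace_inv_self (gF.isUnit_det_metric b' y) (gF.metric_isSymm b' y)
  have ricci_kn :=
    ricciContraction_kulkarniNomizu_self (gF.isUnit_det_metric b' y) (gF.metric_isSymm b' y)
  rw [← inv] at trace_eq ricci_kn
  rw [ricci, inv_warpedMetric, curvature_warpedMetric, ricciContraction_blockCurvature,
    metricTrace_smul_smul, trace_eq, inv_mul_cancel₀ f_ne, one_mul, ricciContraction_smul,
    ricciContraction_sub, ricci_kn]
  congr 1
  ext i j
  simp only [Matrix.add_apply, Matrix.sub_apply, Matrix.smul_apply, smul_eq_mul, scalarQ, ricci]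
  field_simp
  ring

theorem ricciSq_warpedMetric :
    (warpedMetric gB gF f hf hpos).ricciSq (b.prod b') (x, y)
      = Matrix.fromBlocks (gB.ricciSq b x + (Fintype.card κ : ℝ) • gB.tensorST b f x
          + (Fintype.card κ : ℝ) ^ 2 • gB.tensorTSq b f x) 0 0
        ((f x)⁻¹ • (gF.ricciSq b' y
          + (2 * gB.scalarQ b (Fintype.card κ) f x) • gF.ricci b' y
          + gB.scalarQ b (Fintype.card κ) f x ^ 2 • gF.metric b' y)) := by
  have hu := gF.isUnit_det_metric b' y
  have hs := gF.metric_isSymm b' y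
  have contract_left := contract_inv_left hu
  have contract_right := contract_inv_right hu hs
  rw [← inv] at contract_left contract_right
  rw [ricciSq, ricci_warpedMetric, inv_warpedMetric, contract_fromBlocks, contract_add_smul_self,
    contract_smul, contract_add_smul_self, contract_left, contract_left, contract_right,
    (gF.ricci_isSymm b' y).eq, hs.eq, ← two_smul ℝ (gF.ricci b' y), smul_smul, mul_comm]
  rfl

theorem ricciFamily_warpedMetric :
    (warpedMetric gB gF f hf hpos).ricciFamily (b.prod b') (x, y)
      = fun r => Matrix.fromBlocks
        (recombine (baseChange (Fintype.card κ)) (gB.warpingFamily b x f) r) 0 0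
        (recombine (fiberChange (f x) (gB.scalarQ b (Fintype.card κ) f x))
          (gF.ricciFamily b' y) r) := by
  funext r
  fin_cases r
  · change metric _ _ _ = _
    rw [metric_warpedMetric]
    simp [recombine, baseChange, fiberChange, warpingFamily, ricciFamily, Fin.sum_univ_succ]
  · change ricci _ _ _ = _
    rw [ricci_warpedMetric]
    simp [recombine, baseChange, fiberChange, warpingFamily, ricciFamily, Fin.sum_univ_succ,
      add_comm]
  · change ricciSq _ _ _ = _
    rw [ricciSq_warpedMetric]
    congr 1
    · simp [recombine, baseChange, warpingFamily, Fin.sum_univ_succ, add_assoc, add_comm]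
    · simp only [recombine, fiberChange, ricciFamily, Fin.sum_univ_three, Matrix.of_apply,
        Matrix.cons_val', Matrix.cons_val_fin_one, Matrix.cons_val, Fin.reduceFinMk, one_div]
      module

theorem curvature_warpedMetric_eq_kulkarniNomizuForm_iff (L₁ L₂ L₃ L₄ L₅ L₆ : ℝ) :
    (warpedMetric gB gF f hf hpos).curvature (b.prod b') (x, y)
        = kulkarniNomizuForm (roterTable L₁ L₂ L₃ L₄ L₅ L₆)
          ((warpedMetric gB gF f hf hpos).ricciFamily (b.prod b') (x, y)) ↔
      gB.curvature b x
          = kulkarniNomizuForm (baseTable (Fintype.card κ) L₁ L₂ L₃ L₄ L₅ L₆)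
            (gB.warpingFamily b x f) ∧
        tensorForm (mixedTable (Fintype.card κ) (f x) (gB.scalarQ b (Fintype.card κ) f x)
            L₁ L₂ L₃ L₄ L₅ L₆)
          (gB.warpingFamily b x f) (gF.ricciFamily b' y) = 0 ∧
        f x • gF.curvature b' y
          = kulkarniNomizuForm (fiberTable (f x) (gB.scalarP b f x)
              (gB.scalarQ b (Fintype.card κ) f x) L₁ L₂ L₃ L₄ L₅ L₆)
            (gF.ricciFamily b' y) := by
  have f_ne := (hpos x).ne'
  rw [curvature_warpedMetric, ricciFamily_warpedMetric,
    kulkarniNomizuForm_fromBlocks (roterTable_isSymm ..), blockCurvature_inj,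
    kulkarniNomizuForm_recombine, kulkarniNomizuForm_recombine, tensorForm_recombine,
    ← baseTable_eq, mixedTable_eq (hf := f_ne), tensorForm_sub_smul,
    fiberTable_eq (hf := f_ne), kulkarniNomizuForm_add, sub_eq_zero,
    ← sub_eq_iff_eq_add]
  refine and_congr_right' (and_congr (Eq.congr_left ?_) (Eq.congr_left ?_))
  · funext a c i j
    rw [tensorForm_single]
    exact mul_left_comm _ _ _
  · funext i j k l
    simp only [Pi.sub_apply, kulkarniNomizuForm_single, mul_right_comm, div_mul_eq_mul_div]
    rfl

end WarpedProducts

end WarpedRoter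

open WarpedRoter in
theorem theorem5p1_general {E : Type*} [NormedAddCommGroup E] [NormedSpace ℝ E]
    {H : Type*} [TopologicalSpace H] {I : ModelWithCorners ℝ E H} [I.Boundaryless]
    {B : Type*} [TopologicalSpace B] [ChartedSpace H B] [IsManifold I ∞ B]
    {E' : Type*} [NormedAddCommGroup E'] [NormedSpace ℝ E']
    {H' : Type*} [TopologicalSpace H'] {I' : ModelWithCorners ℝ E' H'} [I'.Boundaryless]
    {F : Type*} [TopologicalSpace F] [ChartedSpace H' F] [IsManifold I' ∞ F]
    {ι κ : Type*} [Fintype ι] [DecidableEq ι] [Fintype κ] [DecidableEq κ]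
    (b : Module.Basis ι ℝ E) (b' : Module.Basis κ ℝ E')
    (gB : SemiRiemannianMetric I B) (gF : SemiRiemannianMetric I' F)
    (f : B → ℝ) (hf : ContMDiff I 𝓘(ℝ, ℝ) ∞ f) (hpos : ∀ x, 0 < f x)
    (L₁ L₂ L₃ L₄ L₅ L₆ : B × F → ℝ) :
    (warpedMetric gB gF f hf hpos).IsGeneralizedRoterTypeWith (b.prod b') L₁ L₂ L₃ L₄ L₅ L₆ ↔
      (∀ x y, gB.curvature b x
        = kulkarniNomizuForm (baseTable (Fintype.card κ)
            (L₁ (x, y)) (L₂ (x, y)) (L₃ (x, y)) (L₄ (x, y)) (L₅ (x, y)) (L₆ (x, y)))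
          (gB.warpingFamily b x f)) ∧
      (∀ x y, tensorForm (mixedTable (Fintype.card κ) (f x) (gB.scalarQ b (Fintype.card κ) f x)
            (L₁ (x, y)) (L₂ (x, y)) (L₃ (x, y)) (L₄ (x, y)) (L₅ (x, y)) (L₆ (x, y)))
          (gB.warpingFamily b x f) (gF.ricciFamily b' y) = 0) ∧
      (∀ x y, f x • gF.curvature b' y
        = kulkarniNomizuForm (fiberTable (f x) (gB.scalarP b f x)
            (gB.scalarQ b (Fintype.card κ) f x)
            (L₁ (x, y)) (L₂ (x, y)) (L₃ (x, y)) (L₄ (x, y)) (L₅ (x, y)) (L₆ (x, y)))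
          (gF.ricciFamily b' y)) := by
  rw [SemiRiemannianMetric.isGeneralizedRoterTypeWith_iff, Prod.forall]
  simp only [curvature_warpedMetric_eq_kulkarniNomizuForm_iff, forall_and]

theorem theorem5p1 {p q : ℕ} (hp : 1 ≤ p) (hq : 1 ≤ q)
    (B : Type*) [TopologicalSpace B] [T2Space B] [SecondCountableTopology B] [ConnectedSpace B]
    [ChartedSpace (EuclideanSpace ℝ (Fin p)) B] [IsManifold (𝓡 p) ∞ B]
    (F : Type*) [TopologicalSpace F] [T2Space F] [SecondCountableTopology F] [ConnectedSpace F]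
    [ChartedSpace (EuclideanSpace ℝ (Fin q)) F] [IsManifold (𝓡 q) ∞ F]
    (gB : WarpedRoter.SemiRiemannianMetric (𝓡 p) B)
    (gF : WarpedRoter.SemiRiemannianMetric (𝓡 q) F)
    (f : B → ℝ) (hf : ContMDiff (𝓡 p) 𝓘(ℝ, ℝ) ∞ f) (hpos : ∀ x, 0 < f x)
    (L₁ L₂ L₃ L₄ L₅ L₆ : B × F → ℝ) :
    (WarpedRoter.warpedMetric gB gF f hf hpos).IsGeneralizedRoterTypeWith
        ((WarpedRoter.stdBasis p).prod (WarpedRoter.stdBasis q))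
        L₁ L₂ L₃ L₄ L₅ L₆ ↔
      (∀ (x : B) (y : F), WarpedRoter.BaseCondition gB q f x
        (L₁ (x, y)) (L₂ (x, y)) (L₃ (x, y)) (L₄ (x, y)) (L₅ (x, y)) (L₆ (x, y))) ∧
      (∀ (x : B) (y : F), WarpedRoter.MixedCondition gB gF f x y
        (L₁ (x, y)) (L₂ (x, y)) (L₃ (x, y)) (L₄ (x, y)) (L₅ (x, y)) (L₆ (x, y))) ∧
      (∀ (x : B) (y : F), WarpedRoter.FiberCondition gB gF f x y
        (L₁ (x, y)) (L₂ (x, y)) (L₃ (x, y)) (L₄ (x, y)) (L₅ (x, y)) (L₆ (x, y))) := by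
  simpa only [Fintype.card_fin, funext_iff] using! theorem5p1_general
    (WarpedRoter.stdBasis p) (WarpedRoter.stdBasis q) gB gF f hf hpos L₁ L₂ L₃ L₄ L₅ L₆
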